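/- **Notation.** Let $l^2=l^2(\mathbb Z^+)$ with $\mathbb Z^+=\{0,1,2,\dots\}$, and let $P_n$ ($n\ge 1$) be the orthogonal projection of $l^2$ onto the span of the first $n$ standard basis vectors. For $a\in L^\infty(\mathbb T)$ with Fourier coefficients $a_k$, let $T(a)=(a_{i-j})_{i,j\ge 0}$ be the Toeplitz operator on $l^2$. A bounded function $b:\mathbb Z\to\mathbb C$ is almost periodic, $b\in AP(\mathbb Z)$, if the set of its translates is relatively compact in the supremum norm; then $M(b)=\lim_{n\to\infty}\frac1n\sum_{r=0}^{n-1}b(r)$ is its mean value. Let $\mathcal A=\mathcal A_{L^\infty(\mathbb T),AP(\mathbb Z)}(\mathbb Z^+)$ be the smallest closed $C^*$-subalgebra of $L(l^2)$ containing all $T(a)$ with $a\in L^\infty(\mathbb T)$ and all multiplication operators on $l^2$ by restrictions $b|_{\mathbb Z^+}$ with $b\in AP(\mathbb Z)$. For $B\in\mathcal A$, let $D_{ap}(B)$ denote the function $f\in AP(\mathbb Z)$ for which $B_{nn}-f(n)\to0$ as $n\to\infty$. Let $\mathcal F^{\mathcal P}$ be the $C^*$-algebra of all bounded sequences $\mathbf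 A=(A_n)_{n\ge1}$ of operators $A_n\in L(\operatorname{im}P_n)$ for which the strong limits of $A_nP_n$ and $A_n^*P_n$ exist, with entrywise operations and the supremum norm; let $W(\mathbf A)$ be the strong limit of $A_nP_n$, and let $\mathcal G$ be the ideal of the sequences with $\|A_n\|\to0$. The stability spectrum of $\mathbf A$ is the spectrum $\sigma(\mathbf A+\mathcal G)$ of the coset $\mathbf A+\mathcal G$ in $\mathcal F^{\mathcal P}/\mathcal G$. Let $\mathcal S=\mathcal S_{L^\infty(\mathbb T),AP(\mathbb Z)}(\mathbb Z^+)$ be the smallest closed $C^*$-subalgebra of $\mathcal F^{\mathcal P}$ containing all sequences $(P_nAP_n)$ with $A\in\mathcal A$. For an operator $B$ on an $n$-dimensional space, $\lambda_1(B),\dots,\lambda_n(B)$ are its eigenvalues, counted with algebraic multiplicity. **Theorem.** Let $\mathbf A=(A_n)\in\mathcal S$ be normal, and let $g$ be a complex-valued function which is continuous on a set $U\supseteq\sigma(\mathbf A+\mathcal G)$, where either * $U$ is an open subset of $\mathbb C$, or * $U$ is an open subset of $\mathbb R$ and, for all sufficiently large $n$, all eigenvalues of $A_n$ are real. Then all eigenvalues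 of $A_n$ lie in $U$ for all sufficiently large $n$; $W(\mathbf A)$ is normal with spectrum contained in $U$; the operator $g(W(\mathbf A))$ (continuous functional calculus) belongs to $\mathcal A$; its main diagonal has an almost periodic part $D_{ap}(g(W(\mathbf A)))$, the mean value of which exists; and $$\lim_{n\to\infty}\frac{g(\lambda_1(A_n))+\dots+g(\lambda_n(A_n))}{n}=M\bigl(D_{ap}(g(W(\mathbf A)))\bigr).$$ -/

import Mathlib

open Filter Topology MeasureTheory
open scoped ENNReal InnerProductSpace BoundedContinuousFunction

noncomputable section

namespace Szego

/-! ### Laurent, Toeplitz and multiplication operators -/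

/-- The Hilbert space of square summable sequences indexed by the integers. -/
abbrev L2Z : Type := lp (fun _ : ℤ => ℂ) 2

/-- The Hilbert space of square summable sequences indexed by the non-negative integers. -/
abbrev L2N : Type := lp (fun _ : ℕ => ℂ) 2

/-- The space of essentially bounded functions on the unit circle. The circle is parametrized as
`ℝ / ℤ` through `s ↦ exp (2 π i s)`, with normalized arc length. -/
abbrev LInfT : Type := Lp ℂ ∞ (AddCircle.haarAddCircle : Measure UnitAddCircle)

/-- Square integrable functions on the unit circle. -/
abbrev L2T : Type := Lp ℂ 2 (AddCircle.haarAddCircle : Measure UnitAddCircle)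

/-- Multiplication by an essentially bounded function on the square integrable functions. -/
def mulL2T (a : LInfT) : L2T →L[ℂ] L2T :=
  (ContinuousLinearMap.mul ℂ ℂ).holderL AddCircle.haarAddCircle ∞ 2 2 a

/-- The Laurent operator with generating function `a`: the multiplication by `a`, written in the
Fourier basis. Its matrix is `(a_{i-j})`, see `laurent_entry`. -/
def laurent (a : LInfT) : L2Z →L[ℂ] L2Z :=
  ((fourierBasis (T := 1)).repr.toContinuousLinearEquiv : L2T →L[ℂ] L2Z) ∘L mulL2T a ∘L
    ((fourierBasis (T := 1)).repr.symm.toContinuousLinearEquiv : L2Z →L[ℂ] L2T)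

theorem laurent_entry (a : LInfT) (i j : ℤ) :
    laurent a (lp.single 2 j 1) i = fourierCoeff (a : UnitAddCircle → ℂ) (i - j) := by
  have h1 : (fourierBasis (T := 1)).repr.symm (lp.single 2 j (1 : ℂ)) = fourierLp 2 j := by
    rw [HilbertBasis.repr_symm_single, coe_fourierBasis]
  have h2 : laurent a (lp.single 2 j 1) i =
      fourierCoeff (mulL2T a (fourierLp 2 j) : UnitAddCircle → ℂ) i := by
    rw [← fourierBasis_repr, ← h1]
    rfl
  rw [h2, fourierCoeff, fourierCoeff]
  apply integral_congr_ae
  have h3 := ContinuousLinearMap.coeFn_holder (r := 2) (ContinuousLinearMap.mul ℂ ℂ) a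
    (fourierLp (T := 1) 2 j)
  filter_upwards [h3, coeFn_fourierLp (T := 1) 2 j] with x hx hy
  have : (mulL2T a (fourierLp 2 j) : UnitAddCircle → ℂ) x = a x * fourier j x := by
    rw [← hy]; exact hx
  rw [this, smul_eq_mul, smul_eq_mul, neg_sub, sub_eq_add_neg, fourier_add]
  ring

theorem orthonormal_std :
    Orthonormal ℂ (fun n : ℕ => (lp.single 2 (n : ℤ) (1 : ℂ) : L2Z)) := by
  rw [orthonormal_iff_ite]
  intro i j
  rw [lp.inner_single_left]
  simp [Pi.single_apply]

/-- The natural embedding of the one-sided into the two-sided sequences: it sends the `n`th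
standard basis vector to the `n`th standard basis vector. -/
def embZ : L2N →ₗᵢ[ℂ] L2Z := orthonormal_std.orthogonalFamily.linearIsometry

theorem embZ_single (n : ℕ) : embZ (lp.single 2 n 1) = lp.single 2 (n : ℤ) 1 := by
  simp [embZ, OrthogonalFamily.linearIsometry_apply_single]

/-- The Toeplitz operator with generating function `a`: the compression of the Laurent operator
to the one-sided sequences. -/
def toeplitz (a : LInfT) : L2N →L[ℂ] L2N :=
  ContinuousLinearMap.adjoint embZ.toContinuousLinearMap ∘L laurent a ∘L
    embZ.toContinuousLinearMap

theorem memlp_mul (b : ℤ →ᵇ ℂ) (x : L2N) :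
    Memℓp (fun n : ℕ => b n * x n) 2 := by
  refine memℓp_gen (Summable.of_nonneg_of_le (fun n => by positivity) (fun n => ?_)
    (((lp.memℓp x).summable (by simp)).mul_left (‖b‖ ^ 2)))
  have := b.norm_coe_le_norm n
  simp only [norm_mul, ENNReal.toReal_ofNat, Real.rpow_ofNat, mul_pow]
  gcongr

/-- The operator of multiplication by the restriction of the bounded sequence `b` to the
non-negative integers. -/
def mulOp (b : ℤ →ᵇ ℂ) : L2N →L[ℂ] L2N :=
  LinearMap.mkContinuous
    { toFun := fun x => ⟨fun n => b n * x n, memlp_mul b x⟩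
      map_add' := fun x y => by ext n; exact mul_add _ _ _
      map_smul' := fun c x => by ext n; exact mul_left_comm _ _ _ }
    ‖b‖ (fun x => by
      refine lp.norm_le_of_forall_sum_le (by simp) (by positivity) (fun s => ?_)
      have h := lp.sum_rpow_le_norm_rpow (p := 2) (by simp) x s
      simp only [ENNReal.toReal_ofNat, Real.rpow_ofNat] at h ⊢
      rw [mul_pow]
      refine le_trans ?_ (mul_le_mul_of_nonneg_left h (by positivity))
      rw [Finset.mul_sum]
      refine Finset.sum_le_sum (fun n _ => ?_)
      have := b.norm_coe_le_norm n
      change ‖b n * x n‖ ^ 2 ≤ _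
      rw [norm_mul, mul_pow]
      gcongr)

theorem mulOp_apply (b : ℤ →ᵇ ℂ) (x : L2N) (n : ℕ) : mulOp b x n = b n * x n := rfl

/-! ### Almost periodic functions and their mean values -/

/-- The translate `n ↦ b (n + k)`. -/
def translate (b : ℤ →ᵇ ℂ) (k : ℤ) : ℤ →ᵇ ℂ :=
  b.compContinuous ⟨fun n => n + k, continuous_of_discreteTopology⟩

/-- The almost periodic functions on the integers: the set of the translates is relatively
compact in the supremum norm. -/
def AP : Set (ℤ →ᵇ ℂ) := {b | IsCompact (closure (Set.range (translate b)))}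

/-- `m` is the limit of the arithmetic means of `f 0, f 1, f 2, …`. -/
def HasMean (f : ℤ →ᵇ ℂ) (m : ℂ) : Prop :=
  Tendsto (fun n : ℕ => (∑ r ∈ Finset.range n, f r) / n) atTop (𝓝 m)

/-- The mean value of an almost periodic function (arbitrary if the limit does not exist). -/
def mean (f : ℤ →ᵇ ℂ) : ℂ :=
  limUnder atTop (fun n : ℕ => (∑ r ∈ Finset.range n, f r) / n)

/-! ### The operator algebra and the main diagonal -/

/-- The smallest closed `C^*`-subalgebra of the bounded operators on the one-sided sequences which
contains the Toeplitz operators with generating function in `X` and the operators of multiplication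
by the restrictions of the sequences in `Y`. (In our use, `1` is among the generators.) -/
def opAlg (X : Set LInfT) (Y : Set (ℤ →ᵇ ℂ)) : StarSubalgebra ℂ (L2N →L[ℂ] L2N) :=
  (StarAlgebra.adjoin ℂ (toeplitz '' X ∪ mulOp '' Y)).topologicalClosure

/-- The `n`th entry of the main diagonal. -/
def diag (B : L2N →L[ℂ] L2N) (n : ℕ) : ℂ := B (lp.single 2 n 1) n

/-- `f` is almost periodic, and the main diagonal of `B` differs from the restriction of `f` to the
non-negative integers by a sequence which tends to zero. -/
def IsDap (B : L2N →L[ℂ] L2N) (f : ℤ →ᵇ ℂ) : Prop :=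
  f ∈ AP ∧ Tendsto (fun n : ℕ => diag B n - f n) atTop (𝓝 0)

open Classical in
/-- The almost periodic part of the main diagonal (zero if there is none). -/
def Dap (B : L2N →L[ℂ] L2N) : ℤ →ᵇ ℂ :=
  if h : ∃ f, IsDap B f then h.choose else 0

/-! ### Sequences of matrices -/

/-- The range of the projection `P_{n+1}` onto the first `n + 1` coordinates. -/
abbrev Im (n : ℕ) : Type := EuclideanSpace ℂ (Fin (n + 1))

/-- The inclusion of the range of `P_{n+1}` into the one-sided sequences. -/
def incl (n : ℕ) : Im n →L[ℂ] L2N :=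
  ∑ i : Fin (n + 1), (EuclideanSpace.proj i : Im n →L[ℂ] ℂ).smulRight (lp.single 2 (i : ℕ) 1)

theorem incl_apply (n : ℕ) (x : Im n) (k : ℕ) :
    incl n x k = if h : k < n + 1 then x ⟨k, h⟩ else 0 := by
  have h1 : incl n x k = ∑ i : Fin (n + 1), if k = (i : ℕ) then x i else 0 := by
    simp only [incl, sum_apply, ContinuousLinearMap.smulRight_apply, lp.coeFn_sum,
      Finset.sum_apply, lp.coeFn_smul, Pi.smul_apply, lp.single_apply, Pi.single_apply]
    simp
  rw [h1]
  split_ifs with h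
  · rw [Finset.sum_eq_single ⟨k, h⟩]
    · simp
    · intro i _ hi
      rw [if_neg]
      rintro rfl
      exact hi rfl
    · simp
  · refine Finset.sum_eq_zero (fun i _ => if_neg ?_)
    have := i.2
    omega

/-- The orthogonal projection `P_{n+1}`, as a map onto its range. -/
def proj (n : ℕ) : L2N →L[ℂ] Im n := ContinuousLinearMap.adjoint (incl n)

theorem proj_apply (n : ℕ) (x : L2N) (i : Fin (n + 1)) : proj n x i = x i := by
  have h1 : proj n x i = ⟪EuclideanSpace.single i (1 : ℂ), proj n x⟫_ℂ := by
    rw [EuclideanSpace.inner_single_left]; simp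
  have h2 : incl n (EuclideanSpace.single i (1 : ℂ)) = lp.single 2 (i : ℕ) 1 := by
    ext k
    rw [incl_apply, lp.single_apply]
    by_cases hk : k = i
    · subst hk
      rw [dif_pos i.2]
      simp
    · rw [Pi.single_eq_of_ne hk]
      split_ifs with h
      · simp only [PiLp.single_apply]
        rw [if_neg]
        rintro rfl
        exact hk rfl
      · rfl
  rw [h1, proj, ContinuousLinearMap.adjoint_inner_right, h2, lp.inner_single_left]
  simp

theorem proj_incl (n : ℕ) (x : Im n) : proj n (incl n x) = x := by
  ext i
  rw [proj_apply, incl_apply, dif_pos i.2]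

theorem norm_incl (n : ℕ) (x : Im n) : ‖incl n x‖ = ‖x‖ := by
  have h : ⟪incl n x, incl n x⟫_ℂ = ⟪x, x⟫_ℂ := by
    rw [← ContinuousLinearMap.adjoint_inner_right]
    exact congrArg _ (proj_incl n x)
  rw [inner_self_eq_norm_sq_to_K, inner_self_eq_norm_sq_to_K] at h
  exact (pow_left_inj₀ (norm_nonneg _) (norm_nonneg _) two_ne_zero).1 (by exact_mod_cast h)

theorem norm_incl_le (n : ℕ) : ‖incl n‖ ≤ 1 :=
  ContinuousLinearMap.opNorm_le_bound _ zero_le_one (fun x => by rw [norm_incl, one_mul])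

theorem norm_proj_le (n : ℕ) : ‖proj n‖ ≤ 1 := by
  rw [proj, LinearIsometryEquiv.norm_map]
  exact norm_incl_le n

/-- The projections converge strongly to the identity. -/
theorem tendsto_incl_proj (x : L2N) : Tendsto (fun n => incl n (proj n x)) atTop (𝓝 x) := by
  have h := ((lp.hasSum_single (p := 2) (by simp) x).tendsto_sum_nat).comp (tendsto_add_atTop_nat 1)
  refine h.congr (fun n => ?_)
  ext k
  rw [incl_apply]
  simp only [Function.comp_apply, lp.coeFn_sum, Finset.sum_apply, lp.single_apply]
  split_ifs with hk
  · rw [proj_apply, Finset.sum_eq_single k]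
    · simp
    · intro i _ hi
      exact Pi.single_eq_of_ne hi.symm _
    · simp [hk]
  · refine Finset.sum_eq_zero (fun i hi => Pi.single_eq_of_ne ?_ _)
    rintro rfl
    exact hk (Finset.mem_range.1 hi)

/-- All bounded sequences of operators `A_n` on the range of `P_n`, `n = 1, 2, …`, with the entrywise
operations and the supremum of the operator norms. The entry with index `n` acts on the range of
`P_{n+1}`. -/
def BddSeq : Type := lp (fun n : ℕ => Im n →L[ℂ] Im n) ∞

/-- The `n`th entry of a sequence. -/
def BddSeq.entry (A : BddSeq) (n : ℕ) : Im n →L[ℂ] Im n :=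
  (show lp (fun n : ℕ => Im n →L[ℂ] Im n) ∞ from A) n

instance : CoeFun BddSeq (fun _ => ∀ n : ℕ, Im n →L[ℂ] Im n) := ⟨BddSeq.entry⟩

set_option synthInstance.maxHeartbeats 400000 in
set_option maxHeartbeats 1000000 in
def BddSeq.cstarAlgebra : CStarAlgebra BddSeq :=
  { (inferInstance : NormedRing (lp (fun n : ℕ => Im n →L[ℂ] Im n) ∞)),
    (inferInstance : StarRing (lp (fun n : ℕ => Im n →L[ℂ] Im n) ∞)),
    (inferInstance : NormedAlgebra ℂ (lp (fun n : ℕ => Im n →L[ℂ] Im n) ∞)),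
    (inferInstance : StarModule ℂ (lp (fun n : ℕ => Im n →L[ℂ] Im n) ∞)),
    (inferInstance : CStarRing (lp (fun n : ℕ => Im n →L[ℂ] Im n) ∞)),
    (inferInstance : CompleteSpace (lp (fun n : ℕ => Im n →L[ℂ] Im n) ∞)) with }

instance : CStarAlgebra BddSeq := BddSeq.cstarAlgebra

namespace BddSeq

variable (A B : BddSeq) (c : ℂ) (n : ℕ)

theorem ext {A B : BddSeq} (h : ∀ n, A n = B n) : A = B := lp.ext (funext h)

theorem add_apply : (A + B) n = A n + B n := rfl

theorem mul_apply : (A * B) n = A n * B n := rfl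

theorem smul_apply : (c • A) n = c • A n := rfl

theorem zero_apply : (0 : BddSeq) n = 0 := rfl

theorem one_apply : (1 : BddSeq) n = 1 := rfl

theorem star_apply : (star A) n = star (A n) := rfl

theorem norm_apply_le : ‖A n‖ ≤ ‖A‖ := lp.norm_apply_le_norm ENNReal.top_ne_zero _ n

theorem norm_eq : ‖A‖ = ⨆ n, ‖A n‖ := lp.norm_eq_ciSup _

end BddSeq

/-- The operators `A_n P_n` converge strongly to `T`. -/
def StrongLim (A : BddSeq) (T : L2N →L[ℂ] L2N) : Prop :=
  ∀ x : L2N, Tendsto (fun n => incl n (A n (proj n x))) atTop (𝓝 (T x))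

theorem StrongLim.add {A B : BddSeq} {S T : L2N →L[ℂ] L2N} (hA : StrongLim A S)
    (hB : StrongLim B T) : StrongLim (A + B) (S + T) := fun x =>
  ((hA x).add (hB x)).congr (fun n => by simp [BddSeq.add_apply])

theorem StrongLim.mul {A B : BddSeq} {S T : L2N →L[ℂ] L2N} (hA : StrongLim A S)
    (hB : StrongLim B T) : StrongLim (A * B) (S * T) := by
  intro x
  have h0 : Tendsto (fun n => incl n (B n (proj n x)) - T x) atTop (𝓝 0) := by
    simpa using (hB x).sub_const (T x)
  have h1 : Tendsto (fun n => incl n (A n (proj n (incl n (B n (proj n x)) - T x)))) atTop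
      (𝓝 0) := by
    refine squeeze_zero_norm (fun n => ?_) (by simpa using h0.norm.const_mul ‖A‖)
    rw [norm_incl]
    refine ((A n).le_opNorm _).trans (mul_le_mul (A.norm_apply_le n) ?_
      (norm_nonneg _) (norm_nonneg _))
    exact ((proj n).le_opNorm _).trans (mul_le_of_le_one_left (norm_nonneg _) (norm_proj_le n))
  refine (by simpa using h1.add (hA (T x)) : Tendsto _ _ (𝓝 ((S * T) x))).congr (fun n => ?_)
  simp [proj_incl, BddSeq.mul_apply]

theorem strongLim_algebraMap (c : ℂ) :
    StrongLim (algebraMap ℂ BddSeq c) (algebraMap ℂ (L2N →L[ℂ] L2N) c) := fun x =>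
  ((tendsto_incl_proj x).const_smul c).congr (fun n => by
    rw [Algebra.algebraMap_eq_smul_one, BddSeq.smul_apply, BddSeq.one_apply]; simp)

/-- The `C^*`-algebra of the sequences `(A_n)` for which the strong limits of `A_n P_n` and
`A_n^* P_n` exist. -/
def seqAlg : StarSubalgebra ℂ BddSeq where
  carrier := {A | (∃ T, StrongLim A T) ∧ ∃ T, StrongLim (star A) T}
  mul_mem' := by
    rintro A B ⟨⟨S, hS⟩, S', hS'⟩ ⟨⟨T, hT⟩, T', hT'⟩
    exact ⟨⟨_, hS.mul hT⟩, _, by rw [star_mul]; exact hT'.mul hS'⟩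
  add_mem' := by
    rintro A B ⟨⟨S, hS⟩, S', hS'⟩ ⟨⟨T, hT⟩, T', hT'⟩
    exact ⟨⟨_, hS.add hT⟩, _, by rw [star_add]; exact hS'.add hT'⟩
  algebraMap_mem' := fun c =>
    ⟨⟨_, strongLim_algebraMap c⟩, _, by
      rw [← algebraMap_star_comm]; exact strongLim_algebraMap (star c)⟩
  star_mem' := by
    rintro A ⟨h, h'⟩
    exact ⟨h', by rwa [star_star]⟩

theorem mem_seqAlg {A : BddSeq} :
    A ∈ seqAlg ↔ (∃ T, StrongLim A T) ∧ ∃ T, StrongLim (star A) T := Iff.rfl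

/-- The strong limit of `A_n P_n`. -/
def W (A : seqAlg) : L2N →L[ℂ] L2N := (mem_seqAlg.1 A.2).1.choose

theorem strongLim_W (A : seqAlg) : StrongLim A (W A) := (mem_seqAlg.1 A.2).1.choose_spec

/-- The ideal of the sequences which tend to zero in the norm. -/
def zeroSeq : Ideal seqAlg where
  carrier := {A | Tendsto (fun n => ‖(A : BddSeq) n‖) atTop (𝓝 0)}
  add_mem' := fun {A B} hA hB =>
    squeeze_zero (fun _ => norm_nonneg _) (fun n => norm_add_le ((A : BddSeq) n) ((B : BddSeq) n))
      (by simpa using Tendsto.add hA hB)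
  zero_mem' := by simp [BddSeq.zero_apply]
  smul_mem' := fun A B hB =>
    squeeze_zero (fun _ => norm_nonneg _)
      (fun n => (norm_mul_le ((A : BddSeq) n) ((B : BddSeq) n)).trans (mul_le_mul_of_nonneg_right
        ((A : BddSeq).norm_apply_le n) (norm_nonneg _)))
      (by simpa using Tendsto.const_mul ‖(A : BddSeq)‖ hB)

instance : zeroSeq.IsTwoSided where
  mul_mem_of_left := fun {A} B hA =>
    squeeze_zero (fun _ => norm_nonneg _)
      (fun n => (norm_mul_le ((A : BddSeq) n) ((B : BddSeq) n)).trans (mul_le_mul_of_nonneg_left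
        ((B : BddSeq).norm_apply_le n) (norm_nonneg _)))
      (by simpa using Tendsto.mul_const ‖(B : BddSeq)‖ hA)

/-- The stability spectrum: the spectrum of the coset of `A` modulo the sequences tending to
zero. -/
def stabilitySpectrum (A : seqAlg) : Set ℂ := spectrum ℂ (Ideal.Quotient.mk zeroSeq A)

/-- The finite sections of the operator `T`, as a bounded sequence. -/
def finSecBdd (T : L2N →L[ℂ] L2N) : BddSeq :=
  ⟨fun n => proj n ∘L T ∘L incl n, memℓp_infty ⟨‖T‖, by
    rintro _ ⟨n, rfl⟩
    refine ContinuousLinearMap.opNorm_le_bound _ (norm_nonneg _) (fun x => ?_)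
    calc ‖proj n (T (incl n x))‖ ≤ ‖proj n‖ * ‖T (incl n x)‖ := (proj n).le_opNorm _
      _ ≤ 1 * ‖T (incl n x)‖ := by gcongr; exact norm_proj_le n
      _ ≤ ‖T‖ * ‖x‖ := by rw [one_mul, ← norm_incl n x]; exact T.le_opNorm _⟩⟩

theorem finSecBdd_apply (T : L2N →L[ℂ] L2N) (n : ℕ) :
    finSecBdd T n = proj n ∘L T ∘L incl n := rfl

theorem strongLim_finSecBdd (T : L2N →L[ℂ] L2N) : StrongLim (finSecBdd T) T := by
  intro x
  have h0 : Tendsto (fun n => T (incl n (proj n x)) - T x) atTop (𝓝 0) := by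
    simpa using ((T.continuous.tendsto x).comp (tendsto_incl_proj x)).sub_const (T x)
  have h1 : Tendsto (fun n => incl n (proj n (T (incl n (proj n x)) - T x))) atTop (𝓝 0) := by
    refine squeeze_zero_norm (fun n => ?_) (by simpa using h0.norm)
    rw [norm_incl]
    exact ((proj n).le_opNorm _).trans (mul_le_of_le_one_left (norm_nonneg _) (norm_proj_le n))
  refine (by simpa using h1.add (tendsto_incl_proj (T x)) : Tendsto _ _ (𝓝 (T x))).congr
    (fun n => ?_)
  simp [finSecBdd_apply]

theorem star_finSecBdd (T : L2N →L[ℂ] L2N) : star (finSecBdd T) = finSecBdd (star T) := by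
  refine BddSeq.ext (fun n => ?_)
  change ContinuousLinearMap.adjoint (proj n ∘L T ∘L incl n) =
    proj n ∘L ContinuousLinearMap.adjoint T ∘L incl n
  rw [ContinuousLinearMap.adjoint_comp, ContinuousLinearMap.adjoint_comp, proj,
    ContinuousLinearMap.adjoint_adjoint]
  rfl

/-- The sequence `(P_n T P_n)` of the finite sections of the operator `T`. -/
def finSec (T : L2N →L[ℂ] L2N) : seqAlg :=
  ⟨finSecBdd T, mem_seqAlg.2 ⟨⟨T, strongLim_finSecBdd T⟩, star T, by
    rw [star_finSecBdd]; exact strongLim_finSecBdd _⟩⟩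

/-- The smallest closed `C^*`-subalgebra of `seqAlg` which contains the finite sections sequences
of the operators in `opAlg X Y`. -/
def secAlg (X : Set LInfT) (Y : Set (ℤ →ᵇ ℂ)) : StarSubalgebra ℂ seqAlg :=
  (StarAlgebra.adjoin ℂ (finSec '' (opAlg X Y : Set (L2N →L[ℂ] L2N)))).topologicalClosure

/-- The eigenvalues of `A`, counted with algebraic multiplicity. -/
def eigs {n : ℕ} (A : Im n →L[ℂ] Im n) : Multiset ℂ :=
  (LinearMap.charpoly (A : Im n →ₗ[ℂ] Im n)).roots

end Szego

end

/-!
A normal sequence `A` in the finite sections algebra is handled through its normalized traces.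

*Traces.* The key fact is that `tr(Aₙ)/n` converges to the mean value of the almost periodic part of
the diagonal of `W(A)`, for every `A` in the finite sections algebra (`tendsto_trace`). It rests on
two properties of the operators `B` in the algebra generated by the Toeplitz and the almost periodic
multiplication operators.

* The corner `(I - Pₙ) B Pₙ` has Hilbert–Schmidt norm `o(√n)` (`smallCorner_of_mem_opAlg`). For
  the generators this follows from the square summability of the Fourier coefficients, and the
  property passes to products and uniform limits. Hence the finite sections are multiplicative up
  to sequences which are small in the normalized Hilbert–Schmidt norm. Such sequences form a
  closed ideal, so every `A` in the finite sections algebra differs from the finite sections of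
  `W(A)` by an element of that ideal (`secAlg_structure`), and the normalized trace does not see it.
* The diagonal of `B` is asymptotically almost periodic (`exists_isDap`). A polynomial `B` in the
  generators looks at `+∞` like the same polynomial in Laurent operators and multiplications on
  the two-sided sequences (`exists_follows`). The translates of the latter are relatively compact
  in norm, so its diagonal is almost periodic. The supremum norm of an almost periodic function is
  determined by its behaviour at `+∞` (`norm_le_of_eventually`), which allows passing to limits.

*Functions.* For a continuous function `G` on `ℂ`, the sequence `G(A)` again lies in the finite
sections algebra; its entries are `G(Aₙ)`, its strong limit is `G(W(A))`, and the trace of `G(Aₙ)`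
is the sum of the values of `G` at the eigenvalues of `Aₙ` (`trace_cfc_eq_sum_eigs`).

*Localization.* The stability spectrum is compact, it contains the spectrum of `W(A)`, and the
eigenvalues of `Aₙ` accumulate only on it, since outside of it the resolvents of `Aₙ` are bounded.
So all of them finally lie in a compact set `K ⊆ U` (`exists_compact_subset`), and `g` may be
replaced by a continuous extension `G` of its restriction to `K`.
-/

noncomputable section

namespace Szego

/-! ### The trace of a function of a matrix -/

section Trace

open Polynomial

/-- Both sides are multiplicative in `p`, and for linear `p` this is the value of the characteristic
polynomial. -/
theorem det_aeval_eq_prod_roots {ι : Type*} [Fintype ι] [DecidableEq ι] (A : Matrix ι ι ℂ)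
    (p : ℂ[X]) : (aeval A p).det = (A.charpoly.roots.map p.eval).prod := by
  have hcard : Multiset.card A.charpoly.roots = Fintype.card ι := by
    rw [← (IsAlgClosed.splits A.charpoly).natDegree_eq_card_roots, Matrix.charpoly_natDegree_eq_dim]
  have hC : ∀ c : ℂ, (aeval A (C c)).det = (A.charpoly.roots.map (C c).eval).prod := by
    intro c
    simp only [aeval_C, eval_C, Multiset.map_const', Multiset.prod_replicate, hcard]
    rw [Algebra.algebraMap_eq_smul_one, Matrix.det_smul, Matrix.det_one, mul_one]
  have hX : ∀ r : ℂ, (aeval A (X - C r)).det = (A.charpoly.roots.map (X - C r).eval).prod := by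
    intro r
    have h1 : aeval A (X - C r) = (-1 : ℂ) • (Matrix.scalar ι r - A) := by
      simp [Matrix.scalar_apply, Matrix.algebraMap_eq_diagonal, Pi.algebraMap_def]
    have h2 : A.charpoly.eval r = (A.charpoly.roots.map fun a => r - a).prod := by
      conv_lhs => rw [(IsAlgClosed.splits A.charpoly).eq_prod_roots_of_monic A.charpoly_monic]
      rw [eval_multiset_prod, Multiset.map_map]
      simp
    rw [h1, Matrix.det_smul, ← Matrix.eval_charpoly, h2, ← hcard, ← Multiset.prod_replicate,
      ← Multiset.map_const', ← Multiset.prod_map_mul]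
    simp
  have hmul : ∀ s : Multiset ℂ, (aeval A (s.map fun r => X - C r).prod).det
      = (A.charpoly.roots.map (s.map fun r => X - C r).prod.eval).prod := by
    intro s
    induction s using Multiset.induction with
    | empty => simp
    | cons r s ih =>
      rw [Multiset.map_cons, Multiset.prod_cons, map_mul, Matrix.det_mul, hX, ih,
        ← Multiset.prod_map_mul]
      simp
  rw [(IsAlgClosed.splits p).eq_prod_roots, map_mul, Matrix.det_mul, hC, hmul,
    ← Multiset.prod_map_mul]
  simp

/-- By the determinant formula for the polynomials `c - p`, the characteristic polynomial of `p(A)`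
has the roots `p(λ)`, where `λ` runs over the roots of that of `A`. -/
theorem trace_aeval_eq_sum_roots {ι : Type*} [Fintype ι] [DecidableEq ι] (A : Matrix ι ι ℂ)
    (p : ℂ[X]) : (aeval A p).trace = (A.charpoly.roots.map p.eval).sum := by
  have h : (aeval A p).charpoly = ((A.charpoly.roots.map p.eval).map fun r => X - C r).prod := by
    refine Polynomial.funext fun c => ?_
    have h1 : Matrix.scalar ι c - aeval A p = aeval A (C c - p) := by
      simp [Matrix.scalar_apply, Matrix.algebraMap_eq_diagonal, Pi.algebraMap_def]
    rw [Matrix.eval_charpoly, h1, det_aeval_eq_prod_roots, eval_multiset_prod, Multiset.map_map,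
      Multiset.map_map]
    simp
  rw [Matrix.trace_eq_sum_roots_charpoly, h, roots_multiset_prod_X_sub_C]

theorem mem_eigs {n : ℕ} (A : Im n →L[ℂ] Im n) (z : ℂ) : z ∈ eigs A ↔ z ∈ spectrum ℂ A := by
  rw [eigs, mem_roots (LinearMap.charpoly_monic _).ne_zero,
    ← Module.End.mem_spectrum_iff_isRoot_charpoly]
  have := AlgEquiv.spectrum_eq (Module.End.toContinuousLinearMap (𝕜 := ℂ) (Im n))
    (A : Im n →ₗ[ℂ] Im n)
  rw [← this]
  rfl

/-- The trace of `g(A)` is the sum of the values of `g` at the eigenvalues of `A`: on the finite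
spectrum of `A` the function `g` agrees with an interpolating polynomial. -/
theorem trace_cfc_eq_sum_eigs {n : ℕ} (A : Im n →L[ℂ] Im n) [IsStarNormal A] (g : ℂ → ℂ) :
    LinearMap.trace ℂ (Im n) (cfc g A : Im n →L[ℂ] Im n) = ((eigs A).map g).sum := by
  classical
  let p : ℂ[X] := Lagrange.interpolate (eigs A).toFinset id g
  have hp : ∀ z ∈ eigs A, p.eval z = g z := fun z hz =>
    Lagrange.eval_interpolate_at_node (v := id) g (Function.injective_id.injOn)
      (Multiset.mem_toFinset.2 hz)
  have h1 : cfc g A = aeval A p := by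
    rw [← cfc_polynomial p A]
    exact cfc_congr fun z hz => (hp z ((mem_eigs A z).2 hz)).symm
  have h2 : ((aeval A p : Im n →L[ℂ] Im n) : Im n →ₗ[ℂ] Im n) =
      aeval (A : Im n →ₗ[ℂ] Im n) p :=
    (aeval_algHom_apply (Module.End.toContinuousLinearMap (𝕜 := ℂ) (Im n)).symm A p).symm
  let b := (EuclideanSpace.basisFun (Fin (n + 1)) ℂ).toBasis
  have h3 : LinearMap.toMatrix b b (aeval (A : Im n →ₗ[ℂ] Im n) p) =
      aeval (LinearMap.toMatrix b b (A : Im n →ₗ[ℂ] Im n)) p :=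
    (aeval_algHom_apply (LinearMap.toMatrixAlgEquiv b) (A : Im n →ₗ[ℂ] Im n) p).symm
  rw [h1, h2, LinearMap.trace_eq_matrix_trace ℂ b, h3, trace_aeval_eq_sum_roots,
    LinearMap.charpoly_toMatrix]
  exact congrArg _ (Multiset.map_congr rfl hp)

end Trace

/-! ### Almost periodic functions -/

theorem translate_apply (f : ℤ →ᵇ ℂ) (k n : ℤ) : translate f k n = f (n + k) := rfl

/-- Translations are isometric. -/
theorem norm_translate_sub_translate_le (f : ℤ →ᵇ ℂ) (k l m : ℤ) :
    ‖translate f (k + m) - translate f (l + m)‖ ≤ ‖translate f k - translate f l‖ := by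
  refine (BoundedContinuousFunction.norm_le (norm_nonneg _)).2 fun n => ?_
  have := (translate f k - translate f l).norm_coe_le_norm (n + m)
  simp only [BoundedContinuousFunction.coe_sub, Pi.sub_apply, translate_apply] at this ⊢
  rwa [add_assoc, add_comm m, add_assoc, add_comm m] at this

theorem mem_AP_of_compact {f : ℤ →ᵇ ℂ} {K : Set (ℤ →ᵇ ℂ)} (hK : IsCompact K)
    (h : ∀ k, translate f k ∈ K) : f ∈ AP :=
  hK.closure_of_subset (Set.range_subset_iff.2 h)

theorem translate_mem_closure (f : ℤ →ᵇ ℂ) (k : ℤ) :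
    translate f k ∈ closure (Set.range (translate f)) := subset_closure ⟨k, rfl⟩

theorem sub_mem_AP {f g : ℤ →ᵇ ℂ} (hf : f ∈ AP) (hg : g ∈ AP) : f - g ∈ AP :=
  mem_AP_of_compact ((hf.prod hg).image continuous_sub) fun k =>
    ⟨(translate f k, translate g k), ⟨translate_mem_closure f k, translate_mem_closure g k⟩, rfl⟩

theorem exists_finite_net {f : ℤ →ᵇ ℂ} (hf : f ∈ AP) {ε : ℝ} (hε : 0 < ε) :
    ∃ t : Finset ℤ, ∀ k, ∃ i ∈ t, ‖translate f k - translate f i‖ < ε := by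
  classical
  obtain ⟨t, ht, htf, hc⟩ := Metric.finite_approx_of_totallyBounded
    (hf.totallyBounded.subset subset_closure) ε hε
  choose! c hc' using fun y (hy : y ∈ t) => ht hy
  refine ⟨htf.toFinset.image c, fun k => ?_⟩
  obtain ⟨y, hy, hk⟩ := Set.mem_iUnion₂.1 (hc ⟨k, rfl⟩)
  refine ⟨c y, Finset.mem_image_of_mem c (htf.mem_toFinset.2 hy), ?_⟩
  rw [hc' y hy, ← dist_eq_norm]
  exact hk

/-- The almost periodic functions are closed under uniform limits: a finite net for the translates
of a close function is one for the translates of the limit. -/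
theorem isClosed_AP : IsClosed AP := by
  refine isClosed_of_closure_subset fun f hf => ?_
  have htb : TotallyBounded (Set.range (translate f)) := by
    rw [Metric.totallyBounded_iff]
    intro ε hε
    obtain ⟨g, hg, hfg⟩ := Metric.mem_closure_iff.1 hf (ε / 2) (by positivity)
    obtain ⟨t, ht⟩ := exists_finite_net hg (half_pos hε)
    refine ⟨translate g '' t, t.finite_toSet.image _, ?_⟩
    rintro _ ⟨k, rfl⟩
    obtain ⟨i, hi, hki⟩ := ht k
    refine Set.mem_iUnion₂.2 ⟨_, ⟨i, hi, rfl⟩, ?_⟩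
    have h1 : dist (translate f k) (translate g k) ≤ dist f g :=
      (BoundedContinuousFunction.dist_le dist_nonneg).2 fun n => f.dist_coe_le_dist (n + k)
    rw [Metric.mem_ball]
    rw [← dist_eq_norm] at hki
    linarith [dist_triangle (translate f k) (translate g k) (translate g i)]
  exact (htb.closure).isCompact_of_isClosed isClosed_closure

/-- Almost periods can be found arbitrarily far to the right. -/
theorem exists_almost_period {f : ℤ →ᵇ ℂ} (hf : f ∈ AP) {ε : ℝ} (hε : 0 < ε) (N : ℕ) :
    ∃ n : ℕ, N ≤ n ∧ ‖translate f n - f‖ < ε := by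
  obtain ⟨t, ht⟩ := exists_finite_net hf (half_pos hε)
  choose c hc hcε using ht
  obtain ⟨i, j, hij, h⟩ := Finite.exists_ne_map_eq_of_infinite
    fun i : ℕ => (⟨c (i * N), hc _⟩ : t)
  wlog hlt : i < j generalizing i j
  · exact this j i hij.symm h.symm (lt_of_le_of_ne (not_lt.1 hlt) hij.symm)
  refine ⟨(j - i) * N, Nat.le_mul_of_pos_left _ (Nat.sub_pos_of_lt hlt), ?_⟩
  have h1 : c (i * N) = c (j * N) := congrArg Subtype.val h
  have h2 := norm_translate_sub_translate_le f (j * N) (i * N) (-(i * N))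
  have h3 : translate f (i * N + -(i * N)) = f := by
    ext n; simp [translate_apply]
  have h4 : ((j * N + -(i * N) : ℤ)) = (((j - i) * N : ℕ) : ℤ) := by
    push_cast [Nat.cast_sub hlt.le]; ring
  rw [h3, h4] at h2
  refine h2.trans_lt ?_
  have h5 := hcε (i * N)
  have h6 := hcε (j * N)
  rw [h1] at h5
  rw [norm_sub_rev] at h5
  calc _ = ‖(translate f (j * N) - translate f (c (j * N))) +
        (translate f (c (j * N)) - translate f (i * N))‖ := by rw [sub_add_sub_cancel]
    _ ≤ _ := norm_add_le _ _
    _ < ε := by linarith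

/-- The behaviour at infinity of an almost periodic function bounds its supremum norm. -/
theorem norm_le_of_eventually {f : ℤ →ᵇ ℂ} (hf : f ∈ AP) {C : ℝ} (hC : 0 ≤ C)
    (h : ∀ ε > 0, ∀ᶠ n : ℕ in atTop, ‖f n‖ ≤ C + ε) : ‖f‖ ≤ C := by
  refine (BoundedContinuousFunction.norm_le hC).2 fun k => le_of_forall_pos_le_add fun ε hε => ?_
  obtain ⟨N, hN⟩ := eventually_atTop.1 (h (ε / 2) (half_pos hε))
  obtain ⟨n, hn, hnε⟩ := exists_almost_period hf (half_pos hε) (N + k.natAbs)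
  have h1 := (translate f n - f).norm_coe_le_norm k
  simp only [BoundedContinuousFunction.coe_sub, Pi.sub_apply, translate_apply] at h1
  have h2 := hN (k + n).toNat (by omega)
  rw [Int.toNat_of_nonneg (by omega)] at h2
  rw [norm_sub_rev] at h1
  linarith [norm_le_norm_add_norm_sub' (f k) (f (k + n))]

theorem norm_sum_translate_sub_le (f : ℤ →ᵇ ℂ) (n : ℕ) (k : ℤ) :
    ‖∑ r ∈ Finset.range n, f (r + k) - ∑ r ∈ Finset.range n, f r‖ ≤ 2 * ‖f‖ * |(k : ℝ)| := by
  have hstep : ∀ k : ℤ, ‖∑ r ∈ Finset.range n, f (r + (k + 1)) -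
      ∑ r ∈ Finset.range n, f (r + k)‖ ≤ 2 * ‖f‖ := by
    intro k
    have h := Finset.sum_range_sub (fun r : ℕ => f (r + k)) n
    rw [← Finset.sum_sub_distrib]
    have h' : ∑ r ∈ Finset.range n, (f (r + (k + 1)) - f (r + k)) =
        f (n + k) - f ((0 : ℕ) + k) := by
      rw [← h]
      refine Finset.sum_congr rfl fun r _ => ?_
      push_cast
      rw [add_assoc (r : ℤ) 1 k, add_comm 1 k]
    rw [h', two_mul]
    exact (norm_sub_le _ _).trans (add_le_add (f.norm_coe_le_norm _) (f.norm_coe_le_norm _))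
  induction k using Int.induction_on with
  | zero => simp
  | succ i ih =>
    have h1 := hstep i
    rw [abs_of_nonneg (by positivity)] at ih ⊢
    push_cast at ih ⊢
    calc _ ≤ _ := norm_sub_le_norm_sub_add_norm_sub _ (∑ r ∈ Finset.range n, f (r + (i : ℤ))) _
      _ ≤ 2 * ‖f‖ + 2 * ‖f‖ * i := add_le_add h1 ih
      _ = _ := by ring
  | pred i ih =>
    have h1 := hstep (-i - 1)
    rw [sub_add_cancel, norm_sub_rev] at h1
    rw [abs_of_nonpos (by push_cast; linarith [(Nat.cast_nonneg i : (0 : ℝ) ≤ i)])] at ih ⊢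
    push_cast at ih ⊢
    calc _ ≤ _ := norm_sub_le_norm_sub_add_norm_sub _ (∑ r ∈ Finset.range n, f (r + (-i : ℤ))) _
      _ ≤ 2 * ‖f‖ + 2 * ‖f‖ * - -i := add_le_add h1 ih
      _ = _ := by ring

/-- For an almost periodic function the averages over long windows hardly depend on the position
of the window: up to a small error there are only finitely many positions. -/
theorem eventually_window_sums_close {f : ℤ →ᵇ ℂ} (hf : f ∈ AP) {ε : ℝ} (hε : 0 < ε) :
    ∀ᶠ n : ℕ in atTop, ∀ k : ℤ,
      ‖∑ r ∈ Finset.range n, f (r + k) - ∑ r ∈ Finset.range n, f r‖ ≤ n * ε := by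
  obtain ⟨t, ht⟩ := exists_finite_net hf (half_pos hε)
  have h1 : ∀ᶠ n : ℕ in atTop, ∀ i ∈ t, 2 * ‖f‖ * |(i : ℝ)| ≤ n * (ε / 2) := by
    refine (Filter.eventually_all_finset t).2 fun i _ => ?_
    exact (tendsto_natCast_atTop_atTop.atTop_mul_const (half_pos hε)).eventually_ge_atTop _
  filter_upwards [h1] with n hn k
  obtain ⟨i, hi, hki⟩ := ht k
  have h2 : ‖∑ r ∈ Finset.range n, f (r + k) - ∑ r ∈ Finset.range n, f (r + i)‖ ≤ n * (ε / 2) := by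
    rw [← Finset.sum_sub_distrib]
    refine (norm_sum_le_of_le (f := fun r : ℕ => f (r + k) - f (r + i)) _ fun r _ =>
      ((translate f k - translate f i).norm_coe_le_norm r).trans hki.le).trans ?_
    simp
  calc _ ≤ _ := norm_sub_le_norm_sub_add_norm_sub _ (∑ r ∈ Finset.range n, f (r + i)) _
    _ ≤ n * (ε / 2) + n * (ε / 2) :=
      add_le_add h2 ((norm_sum_translate_sub_le f n i).trans (hn i hi))
    _ = n * ε := by ring

/-- The mean value exists: by comparison with windows, the averages over `m` and over `n` terms are
both close to the average over `m * n` terms. -/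
theorem exists_hasMean {f : ℤ →ᵇ ℂ} (hf : f ∈ AP) : ∃ m, HasMean f m := by
  refine cauchySeq_tendsto_of_complete (Metric.cauchySeq_iff'.2 fun ε hε => ?_)
  obtain ⟨N, hN⟩ := eventually_atTop.1 (eventually_window_sums_close hf
    (show 0 < ε / 3 by positivity))
  -- A sum over `m * n` terms splits into `m` windows of length `n`.
  have key : ∀ m n : ℕ, N ≤ n → ‖∑ r ∈ Finset.range (n * m), f r -
      m * ∑ r ∈ Finset.range n, f r‖ ≤ n * m * (ε / 3) := by
    intro m n hn
    induction m with
    | zero => simp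
    | succ m ih =>
      rw [Nat.mul_succ, Finset.sum_range_add]
      have h1 := hN n hn (n * m : ℕ)
      have h2 : ∑ r ∈ Finset.range n, f ((n * m + r : ℕ) : ℤ) =
          ∑ r ∈ Finset.range n, f (r + (n * m : ℕ)) :=
        Finset.sum_congr rfl fun r _ => by rw [Nat.cast_add, add_comm]
      rw [h2]
      push_cast at h1 ⊢
      rw [add_mul, one_mul, add_sub_add_comm]
      refine (norm_add_le_of_le ih h1).trans_eq ?_
      ring
  have key' : ∀ m n : ℕ, N ≤ n → 0 < n → 0 < m → ‖(∑ r ∈ Finset.range (n * m), f r) / (n * m : ℕ) -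
      (∑ r ∈ Finset.range n, f r) / n‖ ≤ ε / 3 := by
    intro m n hn hn0 hm0
    have hnC : (n : ℂ) ≠ 0 := by exact_mod_cast hn0.ne'
    have hmC : (m : ℂ) ≠ 0 := by exact_mod_cast hm0.ne'
    have h1 : (∑ r ∈ Finset.range (n * m), f r) / (n * m : ℕ) - (∑ r ∈ Finset.range n, f r) / n =
        (∑ r ∈ Finset.range (n * m), f r - m * ∑ r ∈ Finset.range n, f r) / (n * m : ℕ) := by
      push_cast
      field_simp
    rw [h1, norm_div, Complex.norm_natCast, div_le_iff₀ (by positivity)]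
    push_cast
    linarith [key m n hn]
  refine ⟨N + 1, fun n hn => ?_⟩
  have h1 := key' (N + 1) n (by omega) (by omega) (by omega)
  have h2 := key' n (N + 1) (by omega) (by omega) (by omega)
  rw [mul_comm] at h2
  rw [norm_sub_rev] at h1
  rw [dist_eq_norm]
  refine (norm_sub_le_norm_sub_add_norm_sub _ _ _).trans_lt ((add_le_add h1 h2).trans_lt ?_)
  linarith

theorem hasMean_mean {f : ℤ →ᵇ ℂ} (hf : f ∈ AP) : HasMean f (mean f) :=
  tendsto_nhds_limUnder (exists_hasMean hf)

/-! ### Operators on the two-sided sequences and their translates -/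

theorem memlp_shift (k : ℤ) (x : L2Z) : Memℓp (fun n : ℤ => x (n + k)) 2 :=
  memℓp_gen (((lp.memℓp x).summable (by simp)).comp_injective (add_left_injective k))

/-- The unitary shift `(x_n) ↦ (x_{n+k})` on the two-sided sequences. -/
def shift (k : ℤ) : L2Z ≃ₗᵢ[ℂ] L2Z where
  toFun x := ⟨fun n => x (n + k), memlp_shift k x⟩
  invFun x := ⟨fun n => x (n + -k), memlp_shift (-k) x⟩
  left_inv x := by
    ext n
    change x (n + -k + k) = x n
    rw [neg_add_cancel_right]
  right_inv x := by
    ext n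
    change x (n + k + -k) = x n
    rw [add_neg_cancel_right]
  map_add' x y := rfl
  map_smul' c x := rfl
  norm_map' x := by
    rw [lp.norm_eq_tsum_rpow (by simp), lp.norm_eq_tsum_rpow (by simp)]
    congr 1
    exact (Equiv.addRight k).tsum_eq fun n => ‖x n‖ ^ (2 : ℝ≥0∞).toReal

theorem shift_apply (k : ℤ) (x : L2Z) (n : ℤ) : shift k x n = x (n + k) := rfl

theorem shift_symm_apply (k : ℤ) (x : L2Z) (n : ℤ) : (shift k).symm x n = x (n - k) := rfl

theorem shift_symm_single (k j : ℤ) :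
    (shift k).symm (lp.single 2 j 1) = (lp.single 2 (j + k) 1 : L2Z) := by
  ext n
  rw [shift_symm_apply, lp.single_apply, lp.single_apply, Pi.single_apply, Pi.single_apply]
  simp only [sub_eq_iff_eq_add]

/-- The translate of an operator on the two-sided sequences; the entry with index `(i, j)` of its
matrix is the entry with index `(i + k, j + k)` of the given one. -/
def conj (k : ℤ) : (L2Z →L[ℂ] L2Z) ≃⋆ₐ[ℂ] (L2Z →L[ℂ] L2Z) := (shift k).conjStarAlgEquiv

theorem conj_apply (k : ℤ) (A : L2Z →L[ℂ] L2Z) (x : L2Z) :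
    conj k A x = shift k (A ((shift k).symm x)) := rfl

theorem conj_entry (k : ℤ) (A : L2Z →L[ℂ] L2Z) (i j : ℤ) :
    conj k A (lp.single 2 j 1) i = A (lp.single 2 (j + k) 1) (i + k) := by
  rw [conj_apply, shift_symm_single, shift_apply]

theorem norm_conj_le (k : ℤ) (A : L2Z →L[ℂ] L2Z) : ‖conj k A‖ ≤ ‖A‖ :=
  ContinuousLinearMap.opNorm_le_bound _ (norm_nonneg _) fun x => by
    rw [conj_apply, LinearIsometryEquiv.norm_map]
    exact (A.le_opNorm _).trans_eq (by rw [LinearIsometryEquiv.norm_map])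

theorem ext_single {ι F : Type*} [DecidableEq ι] [NormedAddCommGroup F] [NormedSpace ℂ F]
    {A B : lp (fun _ : ι => ℂ) 2 →L[ℂ] F}
    (h : ∀ j, A (lp.single 2 j 1) = B (lp.single 2 j 1)) : A = B := by
  refine lp.ext_continuousLinearMap (by simp) fun j => ?_
  ext
  exact h j

theorem conj_laurent (k : ℤ) (a : LInfT) : conj k (laurent a) = laurent a := by
  refine ext_single fun j => ?_
  ext i
  rw [conj_entry, laurent_entry, laurent_entry, add_sub_add_right_eq_sub]

theorem memlp_mulZ (b : ℤ →ᵇ ℂ) (x : L2Z) : Memℓp (fun n : ℤ => b n * x n) 2 := by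
  refine memℓp_gen (Summable.of_nonneg_of_le (fun n => by positivity) (fun n => ?_)
    (((lp.memℓp x).summable (by simp)).mul_left (‖b‖ ^ 2)))
  have := b.norm_coe_le_norm n
  simp only [norm_mul, ENNReal.toReal_ofNat, Real.rpow_ofNat, mul_pow]
  gcongr

/-- Multiplication by a bounded function on the two-sided sequences, as a bounded linear map of the
function. -/
def mulZ : (ℤ →ᵇ ℂ) →L[ℂ] L2Z →L[ℂ] L2Z :=
  LinearMap.mkContinuous₂
    (LinearMap.mk₂ ℂ (fun b x => (⟨fun n => b n * x n, memlp_mulZ b x⟩ : L2Z))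
      (fun b c x => by ext n; exact add_mul _ _ _)
      (fun c b x => by ext n; exact mul_assoc _ _ _)
      (fun b x y => by ext n; exact mul_add _ _ _)
      (fun c b x => by ext n; exact mul_left_comm _ _ _)) 1 fun b x => by
    rw [one_mul]
    refine lp.norm_le_of_forall_sum_le (by simp) (by positivity) (fun s => ?_)
    have h := lp.sum_rpow_le_norm_rpow (p := 2) (by simp) x s
    simp only [ENNReal.toReal_ofNat, Real.rpow_ofNat] at h ⊢
    rw [mul_pow]
    refine le_trans ?_ (mul_le_mul_of_nonneg_left h (by positivity))
    rw [Finset.mul_sum]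
    refine Finset.sum_le_sum (fun n _ => ?_)
    have := b.norm_coe_le_norm n
    change ‖b n * x n‖ ^ 2 ≤ _
    rw [norm_mul, mul_pow]
    gcongr

theorem mulZ_apply (b : ℤ →ᵇ ℂ) (x : L2Z) (n : ℤ) : mulZ b x n = b n * x n := rfl

theorem conj_mulZ (k : ℤ) (b : ℤ →ᵇ ℂ) : conj k (mulZ b) = mulZ (translate b k) := by
  ext x n
  rw [conj_apply, shift_apply, mulZ_apply, mulZ_apply, shift_symm_apply, translate_apply,
    add_sub_cancel_right]

/-- An operator on the two-sided sequences is almost periodic if its translates are relatively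
compact in the operator norm. -/
def OpAP (A : L2Z →L[ℂ] L2Z) : Prop := ∃ K, IsCompact K ∧ ∀ k, conj k A ∈ K

theorem opAP_laurent (a : LInfT) : OpAP (laurent a) :=
  ⟨{laurent a}, isCompact_singleton, fun k => conj_laurent k a⟩

theorem opAP_mulZ {b : ℤ →ᵇ ℂ} (hb : b ∈ AP) : OpAP (mulZ b) :=
  ⟨_, hb.image mulZ.continuous, fun k => ⟨_, translate_mem_closure b k, (conj_mulZ k b).symm⟩⟩

theorem OpAP.add {A B : L2Z →L[ℂ] L2Z} (hA : OpAP A) (hB : OpAP B) : OpAP (A + B) := by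
  obtain ⟨K, hK, h⟩ := hA
  obtain ⟨L, hL, h'⟩ := hB
  exact ⟨_, (hK.prod hL).image continuous_add, fun k =>
    ⟨(conj k A, conj k B), ⟨h k, h' k⟩, (map_add (conj k) A B).symm⟩⟩

theorem OpAP.mul {A B : L2Z →L[ℂ] L2Z} (hA : OpAP A) (hB : OpAP B) : OpAP (A * B) := by
  obtain ⟨K, hK, h⟩ := hA
  obtain ⟨L, hL, h'⟩ := hB
  exact ⟨_, (hK.prod hL).image continuous_mul, fun k =>
    ⟨(conj k A, conj k B), ⟨h k, h' k⟩, (map_mul (conj k) A B).symm⟩⟩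

theorem OpAP.star {A : L2Z →L[ℂ] L2Z} (hA : OpAP A) : OpAP (star A) := by
  obtain ⟨K, hK, h⟩ := hA
  exact ⟨_, hK.image continuous_star, fun k => ⟨conj k A, h k, (map_star (conj k) A).symm⟩⟩

theorem opAP_algebraMap (c : ℂ) : OpAP (algebraMap ℂ _ c) :=
  ⟨{algebraMap ℂ _ c}, isCompact_singleton, fun k => AlgHomClass.commutes (conj k) c⟩

theorem norm_diagonal_entry_le {ι : Type*} [DecidableEq ι]
    (A : lp (fun _ : ι => ℂ) 2 →L[ℂ] lp (fun _ : ι => ℂ) 2) (n : ι) :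
    ‖A (lp.single 2 n 1) n‖ ≤ ‖A‖ := by
  refine (lp.norm_apply_le_norm (by simp) (A (lp.single 2 n 1)) n).trans
    ((A.le_opNorm _).trans_eq ?_)
  rw [lp.norm_single (by simp), norm_one, mul_one]

/-- The main diagonal of an operator on the two-sided sequences. -/
def diagZ (A : L2Z →L[ℂ] L2Z) : ℤ →ᵇ ℂ :=
  BoundedContinuousFunction.ofNormedAddCommGroupDiscrete (fun n => A (lp.single 2 n 1) n) ‖A‖
    (norm_diagonal_entry_le A)

theorem diagZ_apply (A : L2Z →L[ℂ] L2Z) (n : ℤ) : diagZ A n = A (lp.single 2 n 1) n := rfl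

theorem continuous_diagZ : Continuous diagZ := by
  refine (LipschitzWith.of_dist_le_mul (K := 1) fun A B => ?_).continuous
  rw [NNReal.coe_one, one_mul, BoundedContinuousFunction.dist_le dist_nonneg]
  intro n
  rw [dist_eq_norm, dist_eq_norm]
  exact norm_diagonal_entry_le (A - B) n

theorem translate_diagZ (k : ℤ) (A : L2Z →L[ℂ] L2Z) :
    translate (diagZ A) k = diagZ (conj k A) := by
  ext n
  rw [translate_apply, diagZ_apply, diagZ_apply, conj_entry]

theorem OpAP.diagZ_mem {A : L2Z →L[ℂ] L2Z} (hA : OpAP A) : diagZ A ∈ AP := by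
  obtain ⟨K, hK, h⟩ := hA
  exact mem_AP_of_compact (hK.image continuous_diagZ) fun k =>
    ⟨_, h k, (translate_diagZ k A).symm⟩

/-- A bounded strongly convergent sequence of operators converges uniformly on compact sets. -/
theorem tendsto_apply_of_mem_compact {E F : Type*} [NormedAddCommGroup E] [NormedSpace ℂ E]
    [NormedAddCommGroup F] [NormedSpace ℂ F] {T : ℕ → E →L[ℂ] F} {C : ℝ}
    (hC : ∀ n, ‖T n‖ ≤ C) (hT : ∀ x, Tendsto (fun n => T n x) atTop (𝓝 0)) {K : Set E}
    (hK : IsCompact K) {y : ℕ → E} (hy : ∀ n, y n ∈ K) :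
    Tendsto (fun n => T n (y n)) atTop (𝓝 0) := by
  have hC0 : 0 ≤ C := (norm_nonneg _).trans (hC 0)
  rw [Metric.tendsto_atTop']
  intro ε hε
  obtain ⟨t, -, ht, hKt⟩ := Metric.finite_approx_of_totallyBounded hK.totallyBounded
    (ε / 2 / (C + 1)) (by positivity)
  have h1 : ∀ᶠ n in atTop, ∀ x ∈ t, ‖T n x‖ < ε / 2 :=
    (Filter.eventually_all_finite ht).2 fun x _ => by
      simpa using (hT x).norm.eventually (gt_mem_nhds (by simpa using half_pos hε))
  obtain ⟨N, hN⟩ := eventually_atTop.1 h1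
  refine ⟨N, fun n hn => ?_⟩
  obtain ⟨x, hx, hxy⟩ := Set.mem_iUnion₂.1 (hKt (hy n))
  rw [Metric.mem_ball, dist_eq_norm, lt_div_iff₀ (by positivity)] at hxy
  rw [dist_zero_right]
  calc ‖T n (y n)‖ = ‖T n (y n - x) + T n x‖ := by rw [map_sub, sub_add_cancel]
    _ ≤ ‖T n (y n - x)‖ + ‖T n x‖ := norm_add_le _ _
    _ ≤ C * ‖y n - x‖ + ‖T n x‖ := by
      gcongr
      exact (T n).le_of_opNorm_le (hC n) _
    _ < ε := by nlinarith [hN n hn.le x hx, norm_nonneg (y n - x)]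

/-- A bounded sequence of operators which tends to zero on the standard basis vectors tends
strongly to zero. -/
theorem tendsto_of_tendsto_single {ι F : Type*} [DecidableEq ι] [NormedAddCommGroup F]
    [NormedSpace ℂ F]
    {T : ℕ → lp (fun _ : ι => ℂ) 2 →L[ℂ] F} {C : ℝ} (hC : ∀ n, ‖T n‖ ≤ C)
    (hT : ∀ j, Tendsto (fun n => T n (lp.single 2 j 1)) atTop (𝓝 0))
    (x : lp (fun _ : ι => ℂ) 2) : Tendsto (fun n => T n x) atTop (𝓝 0) := by
  have hC0 : 0 ≤ C := (norm_nonneg _).trans (hC 0)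
  rw [Metric.tendsto_atTop']
  intro ε hε
  obtain ⟨s, hs⟩ := (Metric.tendsto_nhds.1 (lp.hasSum_single (p := 2) (by simp) x)
    (ε / 2 / (C + 1)) (by positivity)).exists
  set y := ∑ i ∈ s, lp.single 2 i (x i) with hy
  have h1 : Tendsto (fun n => T n y) atTop (𝓝 0) := by
    have h2 : ∀ i ∈ s, Tendsto (fun n => x i • T n (lp.single 2 i 1)) atTop (𝓝 0) := fun i _ => by
      simpa using (hT i).const_smul (x i)
    have h3 := tendsto_finsetSum s h2
    rw [Finset.sum_const_zero] at h3
    refine h3.congr fun n => ?_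
    rw [hy, map_sum]
    refine Finset.sum_congr rfl fun i _ => ?_
    rw [← map_smul, ← lp.single_smul, smul_eq_mul, mul_one]
  obtain ⟨N, hN⟩ := eventually_atTop.1 (h1.norm.eventually
    (gt_mem_nhds (show ‖(0 : F)‖ < ε / 2 by simpa using half_pos hε)))
  refine ⟨N, fun n hn => ?_⟩
  rw [dist_comm, dist_eq_norm, lt_div_iff₀ (by positivity)] at hs
  rw [dist_zero_right]
  calc ‖T n x‖ = ‖T n (x - y) + T n y‖ := by rw [map_sub, sub_add_cancel]
    _ ≤ ‖T n (x - y)‖ + ‖T n y‖ := norm_add_le _ _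
    _ ≤ C * ‖x - y‖ + ‖T n y‖ := by
      gcongr
      exact (T n).le_of_opNorm_le (hC n) _
    _ < ε := by nlinarith [hN n hn.le, norm_nonneg (x - y)]

/-! ### The almost periodic part of the main diagonal -/

/-- The restriction of two-sided sequences to the non-negative integers. -/
def restr : L2Z →L[ℂ] L2N := ContinuousLinearMap.adjoint embZ.toContinuousLinearMap

theorem restr_apply (y : L2Z) (n : ℕ) : restr y n = y n := by
  have h : ⟪(lp.single 2 n (1 : ℂ) : L2N), restr y⟫_ℂ = ⟪embZ (lp.single 2 n 1), y⟫_ℂ :=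
    ContinuousLinearMap.adjoint_inner_right _ _ _
  rw [embZ_single, lp.inner_single_left, lp.inner_single_left] at h
  simpa using h

theorem embZ_apply (x : L2N) (n : ℕ) : embZ x (n : ℤ) = x n := by
  have h := embZ.inner_map_map (lp.single 2 n 1) x
  rw [embZ_single, lp.inner_single_left, lp.inner_single_left] at h
  simpa using h

theorem restr_embZ (x : L2N) : restr (embZ x) = x := by
  ext n
  rw [restr_apply, embZ_apply]

theorem norm_embZ_le : ‖embZ.toContinuousLinearMap‖ ≤ 1 := embZ.norm_toContinuousLinearMap_le

theorem norm_restr_le : ‖restr‖ ≤ 1 := by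
  rw [restr, LinearIsometryEquiv.norm_map]
  exact norm_embZ_le

/-- The compression of an operator to the one-sided sequences. -/
def compress (A : L2Z →L[ℂ] L2Z) : L2N →L[ℂ] L2N := restr ∘L A ∘L embZ.toContinuousLinearMap

theorem toeplitz_eq_compress (a : LInfT) : toeplitz a = compress (laurent a) := rfl

theorem mulOp_eq_compress (b : ℤ →ᵇ ℂ) : mulOp b = compress (mulZ b) := by
  ext x n
  change _ = restr (mulZ b (embZ x)) n
  rw [restr_apply, mulOp_apply, mulZ_apply, embZ_apply]

theorem star_compress (A : L2Z →L[ℂ] L2Z) : star (compress A) = compress (star A) := by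
  rw [compress, compress, ContinuousLinearMap.star_eq_adjoint, ContinuousLinearMap.adjoint_comp,
    ContinuousLinearMap.adjoint_comp, restr, ContinuousLinearMap.adjoint_adjoint]
  rfl

/-- The extension by zero of an operator on the one-sided sequences. -/
def lift (B : L2N →L[ℂ] L2N) : L2Z →L[ℂ] L2Z := embZ.toContinuousLinearMap ∘L B ∘L restr

theorem lift_add (B C : L2N →L[ℂ] L2N) : lift (B + C) = lift B + lift C := by
  ext x : 1
  simp [lift]

theorem lift_mul (B C : L2N →L[ℂ] L2N) : lift (B * C) = lift B * lift C := by
  ext x : 1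
  simp [lift, restr_embZ]

theorem norm_lift_le (B : L2N →L[ℂ] L2N) : ‖lift B‖ ≤ ‖B‖ := by
  calc ‖lift B‖ ≤ ‖embZ.toContinuousLinearMap‖ * (‖B‖ * ‖restr‖) :=
        (ContinuousLinearMap.opNorm_comp_le _ _).trans (mul_le_mul_of_nonneg_left
          (ContinuousLinearMap.opNorm_comp_le _ _) (norm_nonneg _))
    _ ≤ 1 * (‖B‖ * 1) := by
        gcongr
        exacts [norm_embZ_le, norm_restr_le]
    _ = ‖B‖ := by ring

theorem lift_compress (A : L2Z →L[ℂ] L2Z) : lift (compress A) = lift 1 * A * lift 1 := rfl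

theorem lift_entry (B : L2N →L[ℂ] L2N) (n : ℕ) :
    lift B (lp.single 2 (n : ℤ) 1) (n : ℤ) = diag B n := by
  change embZ (B (restr _)) (n : ℤ) = _
  rw [embZ_apply, ← embZ_single, restr_embZ]
  rfl

theorem tendsto_conj_lift_one (x : L2Z) :
    Tendsto (fun n : ℕ => (conj n (lift 1) - 1) x) atTop (𝓝 0) := by
  refine tendsto_of_tendsto_single (C := 1 + 1) (fun n => ?_) (fun j => ?_) x
  · refine (norm_sub_le _ _).trans (add_le_add ?_ ?_)
    · exact (norm_conj_le _ _).trans ((norm_lift_le 1).trans ContinuousLinearMap.norm_id_le)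
    · exact ContinuousLinearMap.norm_id_le
  · refine tendsto_const_nhds.congr' ?_
    filter_upwards [eventually_ge_atTop j.natAbs] with n hn
    have h1 : lift 1 (lp.single 2 (j + n) 1) = lp.single 2 (j + n) 1 := by
      obtain ⟨m, hm⟩ := Int.eq_ofNat_of_zero_le (show 0 ≤ j + n by omega)
      change embZ (restr _) = _
      rw [hm, ← embZ_single, restr_embZ]
    rw [sub_apply, conj_apply, shift_symm_single, h1, ← shift_symm_single,
      LinearIsometryEquiv.apply_symm_apply, one_apply_eq_self, sub_self]

/-- The operator `B` on the one-sided sequences looks like the operator `A` at `+∞`: the translates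
to the left of their difference tend strongly to zero. -/
def Follows (B : L2N →L[ℂ] L2N) (A : L2Z →L[ℂ] L2Z) : Prop :=
  ∀ x, Tendsto (fun n : ℕ => conj n (lift B - A) x) atTop (𝓝 0)

theorem Follows.add {B B' : L2N →L[ℂ] L2N} {A A' : L2Z →L[ℂ] L2Z} (h : Follows B A)
    (h' : Follows B' A') : Follows (B + B') (A + A') := fun x => by
  have hs := (h x).add (h' x)
  rw [add_zero] at hs
  refine hs.congr fun n => ?_
  rw [lift_add, add_sub_add_comm, map_add]
  rfl

theorem tendsto_apply_conj {T : ℕ → L2Z →L[ℂ] L2Z} {C : ℝ} (hC : ∀ n, ‖T n‖ ≤ C)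
    (hT : ∀ x, Tendsto (fun n => T n x) atTop (𝓝 0)) {A : L2Z →L[ℂ] L2Z} (hA : OpAP A) (x : L2Z) :
    Tendsto (fun n : ℕ => T n (conj n A x)) atTop (𝓝 0) := by
  obtain ⟨K, hK, h⟩ := hA
  exact tendsto_apply_of_mem_compact hC hT
    (hK.image (ContinuousLinearMap.apply ℂ L2Z x).continuous) fun n => ⟨_, h n, rfl⟩

theorem tendsto_apply_of_bounded {T : ℕ → L2Z →L[ℂ] L2Z} {C : ℝ} (hC : ∀ n, ‖T n‖ ≤ C)
    {y : ℕ → L2Z} (hy : Tendsto y atTop (𝓝 0)) : Tendsto (fun n => T n (y n)) atTop (𝓝 0) :=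
  squeeze_zero_norm (fun n => (T n).le_of_opNorm_le (hC n) _) (by simpa using hy.norm.const_mul C)

/-- The relative compactness of the translates of `A'` compensates for the convergence being only
strong. -/
theorem Follows.mul {B B' : L2N →L[ℂ] L2N} {A A' : L2Z →L[ℂ] L2Z} (h : Follows B A)
    (h' : Follows B' A') (hA' : OpAP A') : Follows (B * B') (A * A') := fun x => by
  have h1 := tendsto_apply_of_bounded (fun n => norm_conj_le (n : ℤ) (lift B)) (h' x)
  have h2 := tendsto_apply_conj (fun n => norm_conj_le (n : ℤ) (lift B - A)) h hA' x
  have hs := h1.add h2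
  rw [add_zero] at hs
  refine hs.congr fun n => ?_
  have h3 : lift (B * B') - A * A' = lift B * (lift B' - A') + (lift B - A) * A' := by
    rw [lift_mul]; noncomm_ring
  rw [h3, map_add, map_mul, map_mul]
  rfl

/-- Seen from far to the right, the projection onto the one-sided sequences is close to the
identity, and it is so uniformly on the relatively compact sets `{conj n A x}`. -/
theorem follows_compress {A : L2Z →L[ℂ] L2Z} (hA : OpAP A) : Follows (compress A) A := fun x => by
  have hb : ∀ n : ℕ, ‖conj n (lift 1 * A)‖ ≤ ‖lift 1 * A‖ := fun n => norm_conj_le n _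
  have h1 := tendsto_apply_of_bounded hb (tendsto_conj_lift_one x)
  have h2 := tendsto_apply_conj (T := fun n => conj n (lift 1) - 1) (C := ‖lift 1 - 1‖)
    (fun n => by
      have h := norm_conj_le n (lift 1 - 1)
      rwa [map_sub, map_one] at h)
    tendsto_conj_lift_one hA x
  have hs := h1.add h2
  rw [add_zero] at hs
  refine hs.congr fun n => ?_
  have h3 : lift (compress A) - A = (lift 1 * A) * (lift 1 - 1) + (lift 1 - 1) * A := by
    rw [lift_compress]; noncomm_ring
  rw [h3, map_add, map_mul (conj n) (lift 1 - 1), map_mul (conj n) (lift 1 * A),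
    map_sub (conj n) (lift 1), map_one]
  rfl

theorem compress_algebraMap (c : ℂ) : compress (algebraMap ℂ _ c) = algebraMap ℂ _ c := by
  ext x : 1
  change restr (c • embZ x) = c • x
  rw [map_smul, restr_embZ]

/-- On the algebra generated by the Toeplitz and the multiplication operators (before the closure
is taken) every operator looks like an almost periodic one at `+∞`. -/
theorem exists_follows {B : L2N →L[ℂ] L2N}
    (hB : B ∈ StarAlgebra.adjoin ℂ (toeplitz '' Set.univ ∪ mulOp '' AP)) :
    ∃ A, OpAP A ∧ Follows B A ∧ Follows (star B) (star A) := by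
  have hgen : ∀ A, OpAP A → ∃ A', OpAP A' ∧ Follows (compress A) A' ∧
      Follows (star (compress A)) (star A') := fun A hA =>
    ⟨A, hA, follows_compress hA, by rw [star_compress]; exact follows_compress hA.star⟩
  induction hB using StarAlgebra.adjoin_induction with
  | mem B hB =>
    rcases hB with ⟨a, -, rfl⟩ | ⟨b, hb, rfl⟩
    · rw [toeplitz_eq_compress]
      exact hgen _ (opAP_laurent a)
    · rw [mulOp_eq_compress]
      exact hgen _ (opAP_mulZ hb)
  | algebraMap c =>
    rw [← compress_algebraMap]
    exact hgen _ (opAP_algebraMap c)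
  | add B C _ _ hB hC =>
    obtain ⟨A, hA, h, h'⟩ := hB
    obtain ⟨A', hA', g, g'⟩ := hC
    exact ⟨A + A', hA.add hA', h.add g, by rw [star_add, star_add]; exact h'.add g'⟩
  | mul B C _ _ hB hC =>
    obtain ⟨A, hA, h, h'⟩ := hB
    obtain ⟨A', hA', g, g'⟩ := hC
    exact ⟨A * A', hA.mul hA', h.mul g hA', by rw [star_mul, star_mul]; exact g'.mul h' hA.star⟩
  | star B _ hB =>
    obtain ⟨A, hA, h, h'⟩ := hB
    exact ⟨star A, hA.star, h', by rwa [star_star, star_star]⟩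

theorem Follows.isDap {B : L2N →L[ℂ] L2N} {A : L2Z →L[ℂ] L2Z} (h : Follows B A) (hA : OpAP A) :
    IsDap B (diagZ A) := by
  refine ⟨hA.diagZ_mem, squeeze_zero_norm (fun n => ?_)
    (tendsto_zero_iff_norm_tendsto_zero.1 (h (lp.single 2 0 1)))⟩
  refine le_trans (le_of_eq ?_) (lp.norm_apply_le_norm (by simp) _ 0)
  rw [conj_entry, zero_add, sub_apply, lp.coeFn_sub, Pi.sub_apply, lift_entry,
    diagZ_apply]

theorem norm_diag_sub_le (B C : L2N →L[ℂ] L2N) (n : ℕ) : ‖diag B n - diag C n‖ ≤ ‖B - C‖ :=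
  norm_diagonal_entry_le (B - C) n

/-- Almost periodic parts of diagonals depend continuously on the operator. In particular, they are
unique. -/
theorem IsDap.norm_sub_le {B C : L2N →L[ℂ] L2N} {f g : ℤ →ᵇ ℂ} (hf : IsDap B f) (hg : IsDap C g) :
    ‖f - g‖ ≤ ‖B - C‖ := by
  refine norm_le_of_eventually (sub_mem_AP hf.1 hg.1) (norm_nonneg _) fun ε hε => ?_
  have h := (hf.2.sub hg.2).norm.eventually (gt_mem_nhds (show ‖(0 - 0 : ℂ)‖ < ε by simpa))
  filter_upwards [h] with n hn
  rw [sub_sub_sub_comm, norm_sub_rev] at hn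
  rw [BoundedContinuousFunction.sub_apply]
  have h1 := norm_diag_sub_le B C n
  linarith [norm_le_norm_add_norm_sub' (f n - g n) (diag B n - diag C n)]

/-- Every operator in the algebra has an almost periodic part of its diagonal. -/
theorem exists_isDap {B : L2N →L[ℂ] L2N} (hB : B ∈ opAlg Set.univ AP) : ∃ f, IsDap B f := by
  obtain ⟨C, hC, hCB⟩ := mem_closure_iff_seq_limit.1 hB
  have hD : ∀ k, ∃ f, IsDap (C k) f := fun k => by
    obtain ⟨A, hA, h, -⟩ := exists_follows (hC k)
    exact ⟨_, h.isDap hA⟩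
  choose f hf using hD
  have hcauchy : CauchySeq f := by
    rw [Metric.cauchySeq_iff]
    intro ε hε
    obtain ⟨N, hN⟩ := Metric.cauchySeq_iff.1 hCB.cauchySeq ε hε
    refine ⟨N, fun m hm n hn => lt_of_le_of_lt ?_ (hN m hm n hn)⟩
    rw [dist_eq_norm, dist_eq_norm]
    exact (hf m).norm_sub_le (hf n)
  obtain ⟨g, hg⟩ := cauchySeq_tendsto_of_complete hcauchy
  refine ⟨g, isClosed_AP.mem_of_tendsto hg (.of_forall fun k => (hf k).1), ?_⟩
  rw [Metric.tendsto_atTop']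
  intro ε hε
  obtain ⟨k, hk1, hk2⟩ := ((Metric.tendsto_nhds.1 hg (ε / 3) (by positivity)).and
    (Metric.tendsto_nhds.1 hCB (ε / 3) (by positivity))).exists
  obtain ⟨N, hN⟩ := eventually_atTop.1 (Metric.tendsto_nhds.1 (hf k).2 (ε / 3) (by positivity))
  refine ⟨N, fun n hn => ?_⟩
  have h1 := hN n hn.le
  have h2 := norm_diag_sub_le B (C k) n
  have h3 : ‖f k n - g n‖ ≤ ‖f k - g‖ := (f k - g).norm_coe_le_norm n
  rw [dist_eq_norm] at hk1 hk2
  rw [norm_sub_rev] at hk2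
  rw [dist_zero_right] at h1 ⊢
  calc ‖diag B n - g n‖ = ‖(diag B n - diag (C k) n) + (diag (C k) n - f k n) + (f k n - g n)‖ := by
        congr 1; ring
    _ ≤ _ := norm_add₃_le
    _ < ε := by linarith

theorem isDap_Dap {B : L2N →L[ℂ] L2N} (hB : B ∈ opAlg Set.univ AP) : IsDap B (Dap B) := by
  have h := exists_isDap hB
  rw [Dap, dif_pos h]
  exact h.choose_spec

theorem tendsto_mean_diag {B : L2N →L[ℂ] L2N} (hB : B ∈ opAlg Set.univ AP) :
    Tendsto (fun n : ℕ => (∑ r ∈ Finset.range n, diag B r) / n) atTop (𝓝 (mean (Dap B))) := by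
  have h := isDap_Dap hB
  refine (by simpa using h.2.cesaro_smul.add (hasMean_mean h.1) :
    Tendsto _ _ (𝓝 (mean (Dap B)))).congr fun n => ?_
  ring

/-! ### Hilbert–Schmidt norms -/

/-- The square of the Hilbert–Schmidt norm. -/
def hsSq {n : ℕ} {H : Type*} [NormedAddCommGroup H] [InnerProductSpace ℂ H] (X : Im n →L[ℂ] H) :
    ℝ := ∑ j, ‖X (EuclideanSpace.single j 1)‖ ^ 2

section HilbertSchmidt

variable {n : ℕ} {H K : Type*} [NormedAddCommGroup H] [InnerProductSpace ℂ H]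
  [NormedAddCommGroup K] [InnerProductSpace ℂ K]

theorem hsSq_nonneg (X : Im n →L[ℂ] H) : 0 ≤ hsSq X := Finset.sum_nonneg fun _ _ => by positivity

theorem hsSq_le (X : Im n →L[ℂ] H) : hsSq X ≤ (n + 1) * ‖X‖ ^ 2 := by
  refine (Finset.sum_le_card_nsmul _ _ (‖X‖ ^ 2) fun j _ => ?_).trans_eq (by simp)
  have h := X.le_opNorm (EuclideanSpace.single j (1 : ℂ))
  rw [PiLp.norm_single, norm_one, mul_one] at h
  gcongr

theorem hsSq_add_le (X Y : Im n →L[ℂ] H) : hsSq (X + Y) ≤ 2 * hsSq X + 2 * hsSq Y := by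
  rw [hsSq, hsSq, hsSq, Finset.mul_sum, Finset.mul_sum, ← Finset.sum_add_distrib]
  refine Finset.sum_le_sum fun j _ => ?_
  rw [add_apply]
  have h := norm_add_le (X (EuclideanSpace.single j 1)) (Y (EuclideanSpace.single j 1))
  nlinarith [sq_nonneg (‖X (EuclideanSpace.single j 1)‖ - ‖Y (EuclideanSpace.single j 1)‖),
    norm_nonneg (X (EuclideanSpace.single j 1) + Y (EuclideanSpace.single j 1))]

theorem hsSq_comp_left_le (Z : H →L[ℂ] K) (X : Im n →L[ℂ] H) :
    hsSq (Z ∘L X) ≤ ‖Z‖ ^ 2 * hsSq X := by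
  rw [hsSq, hsSq, Finset.mul_sum]
  refine Finset.sum_le_sum fun j _ => ?_
  rw [← mul_pow]
  gcongr
  exact Z.le_opNorm _

theorem hsSq_eq_sum_adjoint [FiniteDimensional ℂ H] [CompleteSpace H] {ι : Type*} [Fintype ι]
    (b : OrthonormalBasis ι ℂ H) (X : Im n →L[ℂ] H) :
    hsSq X = ∑ i, ‖ContinuousLinearMap.adjoint X (b i)‖ ^ 2 := by
  have h : ∀ i j, ‖⟪b i, X (EuclideanSpace.single j 1)⟫_ℂ‖ ^ 2 =
      ‖⟪ContinuousLinearMap.adjoint X (b i), EuclideanSpace.basisFun (Fin (n + 1)) ℂ j⟫_ℂ‖ ^ 2 := by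
    intro i j
    rw [ContinuousLinearMap.adjoint_inner_left, EuclideanSpace.basisFun_apply]
  simp_rw [hsSq, ← b.sum_sq_norm_inner_right, h,
    ← (EuclideanSpace.basisFun (Fin (n + 1)) ℂ).sum_sq_norm_inner_left]
  exact Finset.sum_comm

/-- The range of `X` is finite-dimensional, so the Hilbert–Schmidt norm of `X` is that of its
adjoint, on which `Y` acts from the left. -/
theorem hsSq_comp_right_le (X : Im n →L[ℂ] H) (Y : Im n →L[ℂ] Im n) :
    hsSq (X ∘L Y) ≤ ‖Y‖ ^ 2 * hsSq X := by
  let X' : Im n →L[ℂ] X.range := X.codRestrict X.range fun x => LinearMap.mem_range_self _ x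
  have h1 : hsSq X = hsSq X' := rfl
  have h2 : hsSq (X ∘L Y) = hsSq (X' ∘L Y) := rfl
  let b := stdOrthonormalBasis ℂ X.range
  rw [h1, h2, hsSq_eq_sum_adjoint b, hsSq_eq_sum_adjoint b, Finset.mul_sum]
  refine Finset.sum_le_sum fun i _ => ?_
  rw [← mul_pow, ContinuousLinearMap.adjoint_comp]
  gcongr
  exact ((ContinuousLinearMap.adjoint Y).le_opNorm _).trans_eq
    (by rw [LinearIsometryEquiv.norm_map]; rfl)

theorem hsSq_star (X : Im n →L[ℂ] Im n) : hsSq (star X) = hsSq X := by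
  rw [hsSq_eq_sum_adjoint (EuclideanSpace.basisFun (Fin (n + 1)) ℂ),
    ContinuousLinearMap.star_eq_adjoint, ContinuousLinearMap.adjoint_adjoint]
  simp [hsSq]

theorem norm_trace_sq_le (X : Im n →L[ℂ] Im n) :
    ‖LinearMap.trace ℂ (Im n) X‖ ^ 2 ≤ (n + 1) * hsSq X := by
  rw [LinearMap.trace_eq_sum_inner _ (EuclideanSpace.basisFun (Fin (n + 1)) ℂ)]
  have h : ∀ j, ‖⟪EuclideanSpace.basisFun (Fin (n + 1)) ℂ j,
      (X : Im n →ₗ[ℂ] Im n) (EuclideanSpace.basisFun (Fin (n + 1)) ℂ j)⟫_ℂ‖ ≤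
      ‖X (EuclideanSpace.single j 1)‖ := by
    intro j
    refine (norm_inner_le_norm _ _).trans_eq ?_
    rw [OrthonormalBasis.norm_eq_one, one_mul, EuclideanSpace.basisFun_apply]
    rfl
  calc _ ≤ (∑ j, ‖X (EuclideanSpace.single j 1)‖) ^ 2 := by
        gcongr
        exact norm_sum_le_of_le _ fun j _ => h j
    _ ≤ _ := by
        have := sq_sum_le_card_mul_sum_sq (s := Finset.univ)
          (f := fun j : Fin (n + 1) => ‖X (EuclideanSpace.single j 1)‖)
        simpa [hsSq] using this

end HilbertSchmidt

/-- The squares of the Hilbert–Schmidt norms are `o(n)`. -/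
def HSSmall (X : ∀ n : ℕ, Im n →L[ℂ] L2N) : Prop :=
  Tendsto (fun n : ℕ => hsSq (X n) / (n + 1)) atTop (𝓝 0)

namespace HSSmall

variable {X Y : ∀ n : ℕ, Im n →L[ℂ] L2N} {C : ℝ}

theorem of_le (hY : HSSmall Y) (h : ∀ n, hsSq (X n) ≤ C * hsSq (Y n)) : HSSmall X := by
  refine squeeze_zero (fun n => div_nonneg (hsSq_nonneg _) (by positivity)) (fun n => ?_)
    (by simpa using Tendsto.const_mul C hY)
  rw [← mul_div_assoc]
  exact div_le_div_of_nonneg_right (h n) (by positivity)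

theorem add (hX : HSSmall X) (hY : HSSmall Y) : HSSmall fun n => X n + Y n := by
  refine squeeze_zero (fun n => div_nonneg (hsSq_nonneg _) (by positivity)) (fun n => ?_)
    (by simpa using (Tendsto.const_mul 2 hX).add (Tendsto.const_mul 2 hY))
  rw [← mul_div_assoc, ← mul_div_assoc, ← add_div]
  exact div_le_div_of_nonneg_right (hsSq_add_le _ _) (by positivity)

theorem comp_left (hX : HSSmall X) (Z : ℕ → L2N →L[ℂ] L2N) (hZ : ∀ n, ‖Z n‖ ≤ C) :
    HSSmall fun n => Z n ∘L X n :=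
  hX.of_le (C := C ^ 2) fun n => (hsSq_comp_left_le _ _).trans (mul_le_mul_of_nonneg_right
    (pow_le_pow_left₀ (norm_nonneg _) (hZ n) 2) (hsSq_nonneg _))

theorem comp_right (hX : HSSmall X) (Z : ∀ n : ℕ, Im n →L[ℂ] Im n) (hZ : ∀ n, ‖Z n‖ ≤ C) :
    HSSmall fun n => X n ∘L Z n :=
  hX.of_le (C := C ^ 2) fun n => (hsSq_comp_right_le _ _).trans (mul_le_mul_of_nonneg_right
    (pow_le_pow_left₀ (norm_nonneg _) (hZ n) 2) (hsSq_nonneg _))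

theorem of_approx (h : ∀ ε > 0, ∃ Y, HSSmall Y ∧ ∀ n, ‖X n - Y n‖ ≤ ε) : HSSmall X := by
  refine tendsto_order.2 ⟨fun a ha => .of_forall fun n =>
    ha.trans_le (div_nonneg (hsSq_nonneg _) (by positivity)), fun ε hε => ?_⟩
  obtain ⟨Y, hY, hXY⟩ := h (√(ε / 8)) (by positivity)
  filter_upwards [(tendsto_order.1 hY).2 (ε / 8) (by positivity)] with n hn
  rw [div_lt_iff₀ (by positivity)] at hn ⊢
  have h1 := hsSq_add_le (X n - Y n) (Y n)
  have h2 := hsSq_le (X n - Y n)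
  have h3 : ‖X n - Y n‖ ^ 2 ≤ ε / 8 := by
    rw [← Real.sq_sqrt (show 0 ≤ ε / 8 by positivity)]
    exact pow_le_pow_left₀ (norm_nonneg _) (hXY n) 2
  rw [sub_add_cancel] at h1
  nlinarith [mul_le_mul_of_nonneg_left h3 (show (0 : ℝ) ≤ n + 1 by positivity),
    mul_pos hε (show (0 : ℝ) < n + 1 by positivity)]

end HSSmall

/-! ### The off-diagonal corners of operators in the algebra -/

/-- The projection complementary to `P_{n+1}`. -/
def coproj (n : ℕ) : L2N →L[ℂ] L2N := 1 - incl n ∘L proj n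

theorem coproj_apply (n : ℕ) (x : L2N) (k : ℕ) :
    coproj n x k = if k < n + 1 then 0 else x k := by
  change x k - incl n (proj n x) k = _
  rw [incl_apply]
  split_ifs
  · rw [proj_apply, sub_self]
  · rw [sub_zero]

theorem norm_incl_proj_le (n : ℕ) : ‖incl n ∘L proj n‖ ≤ 1 :=
  (ContinuousLinearMap.opNorm_comp_le _ _).trans
    (mul_le_one₀ (norm_incl_le n) (norm_nonneg _) (norm_proj_le n))

theorem norm_coproj_le (n : ℕ) : ‖coproj n‖ ≤ 2 := by
  refine (norm_sub_le _ _).trans ?_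
  have h1 : ‖(1 : L2N →L[ℂ] L2N)‖ ≤ 1 := ContinuousLinearMap.norm_id_le
  linarith [norm_incl_proj_le n]

theorem norm_coproj_sq (n : ℕ) (x : L2N) : ‖coproj n x‖ ^ 2 = ∑' k, ‖x (k + (n + 1))‖ ^ 2 := by
  have h := lp.norm_rpow_eq_tsum (p := 2) (by simp) (coproj n x)
  have hs := (lp.memℓp (coproj n x)).summable (by simp)
  simp only [ENNReal.toReal_ofNat, Real.rpow_ofNat] at h hs
  rw [h, ← hs.sum_add_tsum_nat_add (n + 1), Finset.sum_eq_zero, zero_add]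
  · refine tsum_congr fun k => ?_
    rw [coproj_apply, if_neg (by omega)]
  · intro k hk
    rw [coproj_apply, if_pos (Finset.mem_range.1 hk), norm_zero, zero_pow two_ne_zero]

theorem incl_single (n : ℕ) (j : Fin (n + 1)) :
    incl n (EuclideanSpace.single j 1) = lp.single 2 (j : ℕ) 1 := by
  ext k
  rw [incl_apply, lp.single_apply, Pi.single_apply]
  by_cases hk : k = j
  · subst hk
    rw [dif_pos j.2]
    simp
  · rw [if_neg hk]
    split_ifs with h
    · rw [PiLp.single_apply, if_neg fun hj => hk (congrArg Fin.val hj)]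
    · rfl

/-- The corner of `B` below the `n`th section is small in the Hilbert–Schmidt norm. -/
def SmallCorner (B : L2N →L[ℂ] L2N) : Prop := HSSmall fun n => coproj n ∘L B ∘L incl n

/-- If the squares of the entries are dominated by a summable sequence `c` which depends only on the
diagonal, then the column with index `j` contributes to the `n`th corner at most the tail of `c`
from `n + 1 - j` on, and the arithmetic means of these tails tend to zero. -/
theorem smallCorner_of_entries {B : L2N →L[ℂ] L2N} {c : ℤ → ℝ} (hc : Summable c)
    (h : ∀ i j : ℕ, ‖B (lp.single 2 j 1) i‖ ^ 2 ≤ c (i - j)) : SmallCorner B := by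
  have hcN : Summable fun k : ℕ => c k := hc.comp_injective Nat.cast_injective
  let r : ℕ → ℝ := fun m => ∑' k : ℕ, c ((k + m : ℕ) : ℤ)
  have hr : Tendsto r atTop (𝓝 0) := tendsto_sum_nat_add fun k : ℕ => c k
  have hces := (((tendsto_add_atTop_iff_nat 1).2 hr).cesaro).comp (tendsto_add_atTop_nat 1)
  refine squeeze_zero (fun n => div_nonneg (hsSq_nonneg _) (by positivity)) (fun n => ?_) hces
  have h1 : ∀ j : Fin (n + 1), ‖(coproj n ∘L B ∘L incl n) (EuclideanSpace.single j 1)‖ ^ 2 ≤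
      r (n - j + 1) := by
    intro j
    change ‖coproj n (B (incl n (EuclideanSpace.single j 1)))‖ ^ 2 ≤ _
    have hs := (lp.memℓp (B (lp.single 2 (j : ℕ) 1))).summable (p := 2) (by simp)
    simp only [ENNReal.toReal_ofNat, Real.rpow_ofNat] at hs
    rw [incl_single, norm_coproj_sq]
    have hs1 := (summable_nat_add_iff (n + 1)).2 hs
    have hs2 := (summable_nat_add_iff (f := fun k : ℕ => c k) (n - j + 1)).2 hcN
    refine hs1.tsum_le_tsum (fun k => ?_) hs2
    have h3 : ((k + (n + 1) : ℕ) : ℤ) - (j : ℕ) = ((k + (n - j + 1) : ℕ) : ℤ) := by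
      have := j.2
      omega
    rw [← h3]
    exact h _ _
  have h2 : hsSq (coproj n ∘L B ∘L incl n) ≤ ∑ m ∈ Finset.range (n + 1), r (m + 1) := by
    refine (Finset.sum_le_sum fun j _ => h1 j).trans_eq ?_
    rw [Fin.sum_univ_eq_sum_range (fun j => r (n - j + 1)) (n + 1),
      ← Finset.sum_range_reflect (fun m => r (m + 1)) (n + 1)]
    rfl
  rw [div_eq_inv_mul]
  simp only [Function.comp_apply, Nat.cast_add, Nat.cast_one]
  gcongr

theorem star_entry (B : L2N →L[ℂ] L2N) (i j : ℕ) :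
    ‖star B (lp.single 2 j 1) i‖ = ‖B (lp.single 2 i 1) j‖ := by
  have h := ContinuousLinearMap.adjoint_inner_right B (lp.single 2 i (1 : ℂ)) (lp.single 2 j 1)
  rw [lp.inner_single_left, lp.inner_single_right] at h
  have h' := congrArg norm h
  rw [ContinuousLinearMap.star_eq_adjoint]
  simpa using h'

theorem smallCorner_star_of_entries {B : L2N →L[ℂ] L2N} {c : ℤ → ℝ} (hc : Summable c)
    (h : ∀ i j : ℕ, ‖B (lp.single 2 j 1) i‖ ^ 2 ≤ c (i - j)) : SmallCorner (star B) :=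
  smallCorner_of_entries (c := fun k => c (-k)) (hc.comp_injective neg_injective) fun i j => by
    rw [star_entry, neg_sub]
    exact h j i

theorem SmallCorner.add {A B : L2N →L[ℂ] L2N} (hA : SmallCorner A) (hB : SmallCorner B) :
    SmallCorner (A + B) := by
  have h := HSSmall.add hA hB
  simpa only [SmallCorner, ContinuousLinearMap.add_comp, ContinuousLinearMap.comp_add] using h

theorem norm_finSec_apply_le (A : L2N →L[ℂ] L2N) (n : ℕ) : ‖proj n ∘L A ∘L incl n‖ ≤ ‖A‖ := by
  calc _ ≤ ‖proj n‖ * (‖A‖ * ‖incl n‖) := (ContinuousLinearMap.opNorm_comp_le _ _).trans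
        (mul_le_mul_of_nonneg_left (ContinuousLinearMap.opNorm_comp_le _ _) (norm_nonneg _))
    _ ≤ 1 * (‖A‖ * 1) := by
        gcongr
        exacts [norm_proj_le n, norm_incl_le n]
    _ = ‖A‖ := by ring

theorem SmallCorner.mul {A B : L2N →L[ℂ] L2N} (hA : SmallCorner A) (hB : SmallCorner B) :
    SmallCorner (A * B) := by
  have h1 := hB.comp_left (fun n => coproj n * A) (C := 2 * ‖A‖) fun n =>
    (norm_mul_le _ _).trans (mul_le_mul_of_nonneg_right (norm_coproj_le n) (norm_nonneg _))
  have h2 := hA.comp_right (fun n => proj n ∘L B ∘L incl n) (norm_finSec_apply_le B)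
  have h3 := h1.add h2
  refine (congrArg HSSmall (funext fun n => ?_)).mp h3
  ext x : 1
  change coproj n (A (coproj n (B (incl n x)))) +
    coproj n (A (incl n (proj n (B (incl n x))))) = coproj n (A (B (incl n x)))
  rw [← map_add, ← map_add]
  congr 2
  exact sub_add_cancel _ _

theorem isClosed_smallCorner : IsClosed {B | SmallCorner B} := by
  refine isClosed_of_closure_subset fun B hB => HSSmall.of_approx fun ε hε => ?_
  obtain ⟨C, hC, hBC⟩ := Metric.mem_closure_iff.1 hB (ε / 2) (half_pos hε)
  refine ⟨_, hC, fun n => ?_⟩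
  rw [← ContinuousLinearMap.comp_sub, ← ContinuousLinearMap.sub_comp]
  rw [dist_eq_norm] at hBC
  calc _ ≤ ‖coproj n‖ * (‖B - C‖ * ‖incl n‖) := (ContinuousLinearMap.opNorm_comp_le _ _).trans
        (mul_le_mul_of_nonneg_left (ContinuousLinearMap.opNorm_comp_le _ _) (norm_nonneg _))
    _ ≤ 2 * (ε / 2 * 1) := by
        gcongr
        exacts [norm_coproj_le n, norm_incl_le n]
    _ = ε := by ring

theorem toeplitz_entry (a : LInfT) (i j : ℕ) :
    toeplitz a (lp.single 2 j 1) i = fourierCoeff (a : UnitAddCircle → ℂ) (i - j) := by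
  rw [← laurent_entry, ← embZ_single]
  exact restr_apply _ _

theorem summable_fourierCoeff_sq (a : LInfT) :
    Summable fun k : ℤ => ‖fourierCoeff (a : UnitAddCircle → ℂ) k‖ ^ 2 := by
  have h := (lp.memℓp (laurent a (lp.single 2 0 1))).summable (p := 2) (by simp)
  simpa only [laurent_entry, sub_zero, ENNReal.toReal_ofNat, Real.rpow_ofNat] using h

theorem summable_ite_eq_zero (C : ℝ) : Summable fun k : ℤ => if k = 0 then C else 0 :=
  summable_of_ne_finset_zero (s := {0}) fun k hk => if_neg (by simpa using hk)

theorem norm_mulOp_entry_sq_le (b : ℤ →ᵇ ℂ) (i j : ℕ) :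
    ‖mulOp b (lp.single 2 j 1) i‖ ^ 2 ≤ if (i - j : ℤ) = 0 then ‖b‖ ^ 2 else 0 := by
  rw [mulOp_apply, lp.single_apply, Pi.single_apply]
  by_cases h : i = j
  · subst h
    have := b.norm_coe_le_norm i
    simp only [if_true, mul_one, sub_self]
    gcongr
  · rw [if_neg h, if_neg (by omega)]
    simp

/-- For a product, `(I - P) A B P = (I - P) A (I - P) B P + (I - P) A P B P`, which reduces the
claim to the generators and their adjoints. -/
theorem smallCorner_of_mem_opAlg {B : L2N →L[ℂ] L2N} (hB : B ∈ opAlg Set.univ AP) :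
    SmallCorner B := by
  have h : ∀ B ∈ StarAlgebra.adjoin ℂ (toeplitz '' Set.univ ∪ mulOp '' AP),
      SmallCorner B ∧ SmallCorner (star B) := by
    intro B hB
    induction hB using StarAlgebra.adjoin_induction with
    | mem B hB =>
      rcases hB with ⟨a, -, rfl⟩ | ⟨b, hb, rfl⟩
      · have h : ∀ i j : ℕ, ‖toeplitz a (lp.single 2 j 1) i‖ ^ 2 ≤
            ‖fourierCoeff (a : UnitAddCircle → ℂ) (i - j)‖ ^ 2 := fun i j => by
          rw [toeplitz_entry]
        exact ⟨smallCorner_of_entries (summable_fourierCoeff_sq a) h,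
          smallCorner_star_of_entries (summable_fourierCoeff_sq a) h⟩
      · exact ⟨smallCorner_of_entries (summable_ite_eq_zero _) (norm_mulOp_entry_sq_le b),
          smallCorner_star_of_entries (summable_ite_eq_zero _) (norm_mulOp_entry_sq_le b)⟩
    | algebraMap c =>
      have h : algebraMap ℂ (L2N →L[ℂ] L2N) c = mulOp (algebraMap ℂ _ c) := rfl
      rw [h]
      exact ⟨smallCorner_of_entries (summable_ite_eq_zero _) (norm_mulOp_entry_sq_le _),
        smallCorner_star_of_entries (summable_ite_eq_zero _) (norm_mulOp_entry_sq_le _)⟩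
    | add B C _ _ hB hC => exact ⟨hB.1.add hC.1, by rw [star_add]; exact hB.2.add hC.2⟩
    | mul B C _ _ hB hC => exact ⟨hB.1.mul hC.1, by rw [star_mul]; exact hC.2.mul hB.2⟩
    | star B _ hB => exact ⟨hB.2, by rw [star_star]; exact hB.1⟩
  exact closure_minimal (fun B hB => (h B hB).1) isClosed_smallCorner hB

/-! ### Strong limits and the algebra of sequences -/

theorem StrongLim.unique {A : BddSeq} {S T : L2N →L[ℂ] L2N} (hS : StrongLim A S)
    (hT : StrongLim A T) : S = T :=
  ContinuousLinearMap.ext fun x => tendsto_nhds_unique (hS x) (hT x)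

theorem norm_incl_apply_proj_le (A : BddSeq) (n : ℕ) (x : L2N) :
    ‖incl n (A n (proj n x))‖ ≤ ‖A‖ * ‖x‖ := by
  rw [norm_incl]
  refine ((A n).le_opNorm _).trans (mul_le_mul (A.norm_apply_le n) ?_ (norm_nonneg _)
    (norm_nonneg _))
  exact ((proj n).le_opNorm _).trans (mul_le_of_le_one_left (norm_nonneg _) (norm_proj_le n))

theorem StrongLim.norm_le {A : BddSeq} {T : L2N →L[ℂ] L2N} (h : StrongLim A T) : ‖T‖ ≤ ‖A‖ :=
  ContinuousLinearMap.opNorm_le_bound _ (norm_nonneg _) fun x =>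
    le_of_tendsto (h x).norm (.of_forall fun n => norm_incl_apply_proj_le A n x)

theorem StrongLim.smul {A : BddSeq} {T : L2N →L[ℂ] L2N} (h : StrongLim A T) (c : ℂ) :
    StrongLim (c • A) (c • T) := fun x =>
  ((h x).const_smul c).congr fun n => by rw [BddSeq.smul_apply]; simp

theorem StrongLim.sub {A B : BddSeq} {S T : L2N →L[ℂ] L2N} (hA : StrongLim A S)
    (hB : StrongLim B T) : StrongLim (A - B) (S - T) := by
  have h := hA.add (hB.smul (-1))
  rwa [neg_one_smul, neg_one_smul, ← sub_eq_add_neg, ← sub_eq_add_neg] at h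

theorem StrongLim.eq_star {A : BddSeq} {S T : L2N →L[ℂ] L2N} (hS : StrongLim (star A) S)
    (hT : StrongLim A T) : S = star T := by
  rw [ContinuousLinearMap.star_eq_adjoint, ContinuousLinearMap.eq_adjoint_iff]
  intro x y
  refine tendsto_nhds_unique ((hS x).inner tendsto_const_nhds)
    ((tendsto_const_nhds.inner (hT y)).congr fun n => ?_)
  rw [BddSeq.star_apply, ContinuousLinearMap.star_eq_adjoint]
  have h1 : ∀ (z : L2N) (v : Im n), ⟪z, incl n v⟫_ℂ = ⟪proj n z, v⟫_ℂ := fun z v =>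
    (ContinuousLinearMap.adjoint_inner_left _ _ _).symm
  have h2 : ∀ (z : L2N) (v : Im n), ⟪incl n v, z⟫_ℂ = ⟪v, proj n z⟫_ℂ := fun z v =>
    (ContinuousLinearMap.adjoint_inner_right _ _ _).symm
  rw [h1, h2, ContinuousLinearMap.adjoint_inner_left]

/-- Passing to the strong limit is a homomorphism of star algebras. -/
def strongLimHom : seqAlg →⋆ₐ[ℂ] (L2N →L[ℂ] L2N) where
  toFun := W
  map_one' := (strongLim_W 1).unique (by simpa using strongLim_algebraMap 1)
  map_mul' A B := (strongLim_W (A * B)).unique ((strongLim_W A).mul (strongLim_W B))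
  map_zero' := (strongLim_W 0).unique (by simpa using strongLim_algebraMap 0)
  map_add' A B := (strongLim_W (A + B)).unique ((strongLim_W A).add (strongLim_W B))
  commutes' c := (strongLim_W _).unique (strongLim_algebraMap c)
  map_star' A := StrongLim.eq_star (strongLim_W (star A)) (strongLim_W A)

theorem strongLimHom_apply (A : seqAlg) : strongLimHom A = W A := rfl

theorem continuous_strongLimHom : Continuous strongLimHom := by
  refine (LipschitzWith.of_dist_le_mul (K := 1) fun A B => ?_).continuous
  rw [NNReal.coe_one, one_mul, dist_eq_norm, ← map_sub, dist_eq_norm]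
  exact (strongLim_W (A - B)).norm_le

/-- The strong limits of a convergent sequence of elements form a Cauchy sequence in norm. -/
theorem isClosed_setOf_strongLim : IsClosed {A : BddSeq | ∃ T, StrongLim A T} := by
  refine isClosed_of_closure_subset fun A hA => ?_
  obtain ⟨B, hB, hBA⟩ := mem_closure_iff_seq_limit.1 hA
  choose T hT using hB
  have hcauchy : CauchySeq T := by
    rw [Metric.cauchySeq_iff]
    intro ε hε
    obtain ⟨N, hN⟩ := Metric.cauchySeq_iff.1 hBA.cauchySeq ε hε
    refine ⟨N, fun m hm n hn => lt_of_le_of_lt ?_ (hN m hm n hn)⟩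
    rw [dist_eq_norm, dist_eq_norm]
    exact ((hT m).sub (hT n)).norm_le
  obtain ⟨S, hS⟩ := cauchySeq_tendsto_of_complete hcauchy
  refine ⟨S, fun x => ?_⟩
  rw [Metric.tendsto_atTop']
  intro ε hε
  have hδ : 0 < ε / 3 / (‖x‖ + 1) := by positivity
  obtain ⟨k, hk1, hk2⟩ := ((Metric.tendsto_nhds.1 hS _ hδ).and
    (Metric.tendsto_nhds.1 hBA _ hδ)).exists
  obtain ⟨N, hN⟩ := eventually_atTop.1
    (Metric.tendsto_nhds.1 (hT k x) (ε / 3) (by positivity))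
  refine ⟨N, fun n hn => ?_⟩
  have h1 := hN n hn.le
  have h2 := norm_incl_apply_proj_le (A - B k) n x
  have h3 := (T k - S).le_opNorm x
  have h4 : incl n ((A - B k) n (proj n x)) =
      incl n (A n (proj n x)) - incl n (B k n (proj n x)) := by
    rw [← map_sub]; rfl
  rw [h4] at h2
  rw [sub_apply] at h3
  rw [dist_eq_norm] at hk1 hk2 h1 ⊢
  rw [norm_sub_rev] at hk2
  rw [lt_div_iff₀ (by positivity)] at hk1 hk2
  calc _ = ‖(incl n (A n (proj n x)) - incl n (B k n (proj n x))) +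
        (incl n (B k n (proj n x)) - T k x) + (T k x - S x)‖ := by congr 1; abel
    _ ≤ _ := norm_add₃_le
    _ < ε := by nlinarith [norm_nonneg (A - B k), norm_nonneg (T k - S)]

instance isClosed_seqAlg : IsClosed (seqAlg : Set BddSeq) :=
  isClosed_setOf_strongLim.inter (isClosed_setOf_strongLim.preimage continuous_star)

/-- The `n`th entry, as a homomorphism of star algebras. -/
def entryHom (n : ℕ) : seqAlg →⋆ₐ[ℂ] (Im n →L[ℂ] Im n) where
  toFun A := (A : BddSeq) n
  map_one' := rfl
  map_mul' _ _ := rfl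
  map_zero' := rfl
  map_add' _ _ := rfl
  commutes' c := by
    rw [Algebra.algebraMap_eq_smul_one, Algebra.algebraMap_eq_smul_one]
    rfl
  map_star' _ := rfl

theorem continuous_entryHom (n : ℕ) : Continuous (entryHom n) := by
  refine (LipschitzWith.of_dist_le_mul (K := 1) fun A B => ?_).continuous
  rw [NNReal.coe_one, one_mul, dist_eq_norm, ← map_sub, dist_eq_norm]
  exact BddSeq.norm_apply_le _ n

theorem W_cfc (A : seqAlg) [IsStarNormal A] {g : ℂ → ℂ} (hg : Continuous g) :
    W (cfc g A) = cfc g (W A) :=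
  strongLimHom.map_cfc g A hg.continuousOn continuous_strongLimHom inferInstance
    (IsStarNormal.map strongLimHom A)

theorem entry_cfc (A : seqAlg) [IsStarNormal A] {g : ℂ → ℂ} (hg : Continuous g) (n : ℕ) :
    ((cfc g A : seqAlg) : BddSeq) n = cfc g ((A : BddSeq) n) :=
  (entryHom n).map_cfc g A hg.continuousOn (continuous_entryHom n) inferInstance
    (IsStarNormal.map (entryHom n) A)

theorem cfc_mem_secAlg {A : seqAlg} (hA : A ∈ secAlg Set.univ AP) (g : ℂ → ℂ) :
    cfc g A ∈ secAlg Set.univ AP :=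
  have : IsClosed (secAlg Set.univ AP : Set seqAlg) :=
    StarSubalgebra.isClosed_topologicalClosure _
  cfc_mem g hA

theorem cfc_mem_opAlg {B : L2N →L[ℂ] L2N} (hB : B ∈ opAlg Set.univ AP) (g : ℂ → ℂ) :
    cfc g B ∈ opAlg Set.univ AP :=
  have : IsClosed (opAlg Set.univ AP : Set (L2N →L[ℂ] L2N)) :=
    StarSubalgebra.isClosed_topologicalClosure _
  cfc_mem g hB

/-! ### Sequences which are small in the normalized Hilbert–Schmidt norm -/

/-- The squares of the Hilbert–Schmidt norms of the entries are `o(n)`. -/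
def SeqSmall (X : BddSeq) : Prop := HSSmall fun n => incl n ∘L X n

theorem hsSq_incl_comp {n : ℕ} (X : Im n →L[ℂ] Im n) : hsSq (incl n ∘L X) = hsSq X := by
  simp [hsSq, norm_incl]

theorem SeqSmall.add {X Y : BddSeq} (hX : SeqSmall X) (hY : SeqSmall Y) : SeqSmall (X + Y) := by
  refine (congrArg HSSmall (funext fun n => ?_)).mp (HSSmall.add hX hY)
  rw [BddSeq.add_apply, ContinuousLinearMap.comp_add]

theorem SeqSmall.mul_right {X : BddSeq} (hX : SeqSmall X) (Y : BddSeq) : SeqSmall (X * Y) :=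
  HSSmall.comp_right hX Y.entry Y.norm_apply_le

theorem SeqSmall.star {X : BddSeq} (hX : SeqSmall X) : SeqSmall (star X) :=
  HSSmall.of_le (C := 1) hX fun n => by
    rw [hsSq_incl_comp, hsSq_incl_comp, BddSeq.star_apply, hsSq_star, one_mul]

theorem SeqSmall.mul_left {X : BddSeq} (hX : SeqSmall X) (Y : BddSeq) : SeqSmall (Y * X) := by
  have h := (hX.star.mul_right (Star.star Y)).star
  rwa [star_mul, star_star, star_star] at h

theorem seqSmall_zero : SeqSmall 0 := by
  have h : ∀ n : ℕ, hsSq (incl n ∘L (0 : BddSeq) n) = 0 := fun n => by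
    rw [BddSeq.zero_apply]; simp [hsSq]
  simp [SeqSmall, HSSmall, h]

theorem isClosed_seqSmall : IsClosed {X | SeqSmall X} := by
  refine isClosed_of_closure_subset fun X hX => HSSmall.of_approx fun ε hε => ?_
  obtain ⟨Y, hY, hXY⟩ := Metric.mem_closure_iff.1 hX ε hε
  refine ⟨_, hY, fun n => ?_⟩
  rw [← ContinuousLinearMap.comp_sub]
  rw [dist_eq_norm] at hXY
  calc _ ≤ ‖incl n‖ * ‖(X - Y) n‖ := ContinuousLinearMap.opNorm_comp_le _ _
    _ ≤ 1 * ε := mul_le_mul (norm_incl_le n) (((X - Y).norm_apply_le n).trans hXY.le)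
        (norm_nonneg _) zero_le_one
    _ = ε := one_mul _

theorem finSecBdd_add (S T : L2N →L[ℂ] L2N) : finSecBdd (S + T) = finSecBdd S + finSecBdd T :=
  BddSeq.ext fun n => by
    rw [BddSeq.add_apply, finSecBdd_apply, finSecBdd_apply, finSecBdd_apply,
      ContinuousLinearMap.add_comp, ContinuousLinearMap.comp_add]

theorem finSecBdd_algebraMap (c : ℂ) : finSecBdd (algebraMap ℂ _ c) = algebraMap ℂ _ c :=
  BddSeq.ext fun n => by
    rw [finSecBdd_apply, Algebra.algebraMap_eq_smul_one, Algebra.algebraMap_eq_smul_one,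
      BddSeq.smul_apply, BddSeq.one_apply]
    ext x : 1
    change proj n (c • incl n x) = c • x
    rw [map_smul, proj_incl]

/-- The finite sections of a product differ from the product of the finite sections by a corner. -/
theorem seqSmall_finSecBdd_mul (S : L2N →L[ℂ] L2N) {T : L2N →L[ℂ] L2N} (hT : SmallCorner T) :
    SeqSmall (finSecBdd S * finSecBdd T - finSecBdd (S * T)) := by
  have h := hT.comp_left (fun n => -((incl n ∘L proj n) * S)) (C := 1 * ‖S‖) fun n => by
    rw [norm_neg]
    exact (norm_mul_le _ _).trans (mul_le_mul_of_nonneg_right (norm_incl_proj_le n) (norm_nonneg _))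
  refine (congrArg HSSmall (funext fun n => ?_)).mp h
  ext x : 1
  change -incl n (proj n (S (T (incl n x) - incl n (proj n (T (incl n x)))))) =
    incl n (proj n (S (incl n (proj n (T (incl n x))))) - proj n (S (T (incl n x))))
  rw [← map_neg, ← map_neg, ← map_neg, neg_sub, map_sub, map_sub]

theorem W_finSec (T : L2N →L[ℂ] L2N) : W (finSec T) = T :=
  (strongLim_W (finSec T)).unique (strongLim_finSecBdd T)

/-- Up to an error which is small in the normalized Hilbert–Schmidt norm, a sequence in the finite
sections algebra consists of the finite sections of its strong limit. -/
theorem secAlg_structure {A : seqAlg} (hA : A ∈ secAlg Set.univ AP) :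
    W A ∈ opAlg Set.univ AP ∧ SeqSmall ((A : BddSeq) - finSecBdd (W A)) := by
  have hclosed : IsClosed {A : seqAlg | W A ∈ opAlg Set.univ AP ∧
      SeqSmall ((A : BddSeq) - finSecBdd (W A))} := by
    have hfin : Continuous fun A : seqAlg => finSecBdd (W A) := by
      have h1 : Continuous finSecBdd := by
        refine (LipschitzWith.of_dist_le_mul (K := 1) fun S T => ?_).continuous
        rw [NNReal.coe_one, one_mul, dist_eq_norm, dist_eq_norm, BddSeq.norm_eq]
        refine ciSup_le fun n => ?_
        refine le_trans (le_of_eq ?_) (norm_finSec_apply_le (S - T) n)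
        rw [ContinuousLinearMap.sub_comp, ContinuousLinearMap.comp_sub]
        rfl
      exact h1.comp continuous_strongLimHom
    exact ((StarSubalgebra.isClosed_topologicalClosure _).preimage continuous_strongLimHom).inter
      (isClosed_seqSmall.preimage (continuous_subtype_val.sub hfin))
  refine closure_minimal (fun A hA => ?_) hclosed hA
  change W A ∈ opAlg Set.univ AP ∧ SeqSmall ((A : BddSeq) - finSecBdd (W A))
  induction hA using StarAlgebra.adjoin_induction with
  | mem A hA =>
    obtain ⟨T, hT, rfl⟩ := hA
    rw [W_finSec]
    refine ⟨hT, ?_⟩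
    change SeqSmall (finSecBdd T - finSecBdd T)
    rw [sub_self]
    exact seqSmall_zero
  | algebraMap c =>
    have h : W (algebraMap ℂ seqAlg c) = algebraMap ℂ _ c := AlgHomClass.commutes strongLimHom c
    rw [h, finSecBdd_algebraMap]
    refine ⟨algebraMap_mem _ c, ?_⟩
    change SeqSmall (algebraMap ℂ BddSeq c - algebraMap ℂ BddSeq c)
    rw [sub_self]
    exact seqSmall_zero
  | add A B _ _ hA hB =>
    have h : W (A + B) = W A + W B := map_add strongLimHom A B
    rw [h]
    refine ⟨add_mem hA.1 hB.1, ?_⟩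
    have := hA.2.add hB.2
    rwa [sub_add_sub_comm, ← finSecBdd_add] at this
  | mul A B _ _ hA hB =>
    have h : W (A * B) = W A * W B := map_mul strongLimHom A B
    rw [h]
    refine ⟨mul_mem hA.1 hB.1, ?_⟩
    have h1 := (hA.2.mul_right B).add (hB.2.mul_left (finSecBdd (W A)))
    have h2 := h1.add (seqSmall_finSecBdd_mul (W A) (smallCorner_of_mem_opAlg hB.1))
    refine (congrArg SeqSmall ?_).mp h2
    change _ = (A : BddSeq) * (B : BddSeq) - finSecBdd (W A * W B)
    noncomm_ring
  | star A _ hA =>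
    have h : W (star A) = star (W A) := map_star strongLimHom A
    rw [h]
    refine ⟨star_mem hA.1, ?_⟩
    have := hA.2.star
    rwa [star_sub, star_finSecBdd] at this

theorem trace_finSecBdd (T : L2N →L[ℂ] L2N) (n : ℕ) :
    LinearMap.trace ℂ (Im n) (finSecBdd T n : Im n →L[ℂ] Im n) =
      ∑ r ∈ Finset.range (n + 1), diag T r := by
  rw [LinearMap.trace_eq_sum_inner _ (EuclideanSpace.basisFun (Fin (n + 1)) ℂ),
    ← Fin.sum_univ_eq_sum_range]
  refine Finset.sum_congr rfl fun j _ => ?_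
  rw [EuclideanSpace.basisFun_apply, EuclideanSpace.inner_single_left, map_one, one_mul]
  change proj n (T (incl n (EuclideanSpace.single j 1))) j = _
  rw [proj_apply, incl_single]
  rfl

theorem SeqSmall.tendsto_trace {X : BddSeq} (hX : SeqSmall X) :
    Tendsto (fun n : ℕ => LinearMap.trace ℂ (Im n) (X n : Im n →L[ℂ] Im n) / ((n + 1 : ℕ) : ℂ))
      atTop (𝓝 0) := by
  have h : Tendsto (fun n : ℕ => √(hsSq (incl n ∘L X n) / (n + 1))) atTop (𝓝 0) := by
    have h := (Real.continuous_sqrt.tendsto 0).comp hX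
    rwa [Real.sqrt_zero] at h
  refine squeeze_zero_norm (fun n => Real.le_sqrt_of_sq_le ?_) h
  rw [hsSq_incl_comp, norm_div, div_pow, Complex.norm_natCast, div_le_div_iff₀ (by positivity)
    (by positivity)]
  push_cast
  nlinarith [mul_le_mul_of_nonneg_right (norm_trace_sq_le (X n))
    (show (0 : ℝ) ≤ n + 1 by positivity)]

/-- The normalized traces of a sequence in the finite sections algebra converge to the mean value
of the almost periodic part of the diagonal of its strong limit. -/
theorem tendsto_trace {A : seqAlg} (hA : A ∈ secAlg Set.univ AP) :
    Tendsto (fun n : ℕ => LinearMap.trace ℂ (Im n) ((A : BddSeq) n : Im n →L[ℂ] Im n) /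
      ((n + 1 : ℕ) : ℂ)) atTop (𝓝 (mean (Dap (W A)))) := by
  obtain ⟨hW, hs⟩ := secAlg_structure hA
  have h1 := (tendsto_mean_diag hW).comp (tendsto_add_atTop_nat 1)
  have h2 := hs.tendsto_trace.add h1
  rw [zero_add] at h2
  refine h2.congr fun n => ?_
  rw [Function.comp_apply, ← trace_finSecBdd, ← add_div, ← map_add]
  congr 2
  change ((A : BddSeq) n : Im n →ₗ[ℂ] Im n) - (finSecBdd (W A) n : Im n →ₗ[ℂ] Im n) + _ = _
  exact sub_add_cancel _ _

/-! ### The stability spectrum and the eigenvalues of the sections -/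

theorem mem_zeroSeq {A : seqAlg} :
    A ∈ zeroSeq ↔ Tendsto (fun n => ‖(A : BddSeq) n‖) atTop (𝓝 0) := Iff.rfl

theorem W_eq_zero_of_mem_zeroSeq {A : seqAlg} (hA : A ∈ zeroSeq) : W A = 0 := by
  refine (strongLim_W A).unique fun x => squeeze_zero_norm (fun n => ?_)
    (by simpa using (mem_zeroSeq.1 hA).mul_const ‖x‖)
  rw [norm_incl]
  refine ((A : BddSeq) n).le_opNorm_of_le ?_
  exact ((proj n).le_opNorm _).trans (mul_le_of_le_one_left (norm_nonneg _) (norm_proj_le n))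

theorem exists_inverse_mod_zeroSeq {A : seqAlg} {z : ℂ} (hz : z ∉ stabilitySpectrum A) :
    ∃ B : seqAlg, 1 - B * (algebraMap ℂ _ z - A) ∈ zeroSeq ∧
      1 - (algebraMap ℂ _ z - A) * B ∈ zeroSeq := by
  obtain ⟨⟨a, b, hab, hba⟩, ha⟩ := spectrum.notMem_iff.1 hz
  obtain ⟨B, rfl⟩ := Ideal.Quotient.mk_surjective b
  have h : Ideal.Quotient.mk zeroSeq (algebraMap ℂ _ z - A) = a := by
    rw [map_sub]
    exact ha.symm
  subst h
  refine ⟨B, ?_, ?_⟩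
  · rw [← Ideal.Quotient.eq_zero_iff_mem, map_sub, map_one, map_mul, hba, sub_self]
  · rw [← Ideal.Quotient.eq_zero_iff_mem, map_sub, map_one, map_mul, hab, sub_self]

theorem spectrum_W_subset (A : seqAlg) : spectrum ℂ (W A) ⊆ stabilitySpectrum A := by
  intro z hz
  by_contra hz'
  obtain ⟨B, h1, h2⟩ := exists_inverse_mod_zeroSeq hz'
  have h3 := W_eq_zero_of_mem_zeroSeq h1
  have h4 := W_eq_zero_of_mem_zeroSeq h2
  have hc : strongLimHom (algebraMap ℂ seqAlg z) = algebraMap ℂ _ z :=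
    AlgHomClass.commutes strongLimHom z
  rw [← strongLimHom_apply, map_sub, map_one, map_mul, map_sub, hc, sub_eq_zero] at h3 h4
  exact hz ⟨⟨_, _, h4.symm, h3.symm⟩, rfl⟩

/-- The quotient algebra needs no norm here: invertibility modulo the ideal persists under small
perturbations because it does so in `seqAlg`. -/
theorem isCompact_stabilitySpectrum (A : seqAlg) : IsCompact (stabilitySpectrum A) := by
  have hsub : stabilitySpectrum A ⊆ spectrum ℂ A :=
    AlgHom.spectrum_apply_subset (Ideal.Quotient.mkₐ ℂ zeroSeq) A
  refine (spectrum.isCompact (𝕜 := ℂ) A).of_isClosed_subset ?_ hsub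
  rw [← isOpen_compl_iff, Metric.isOpen_iff]
  intro z hz
  obtain ⟨B, h1, h2⟩ := exists_inverse_mod_zeroSeq hz
  refine ⟨1 / (‖B‖ + 1), by positivity, fun w hw => ?_⟩
  rw [Metric.mem_ball, dist_eq_norm, lt_div_iff₀ (by positivity)] at hw
  -- `w - A` is `z - A` times a perturbation of the identity, up to a sequence tending to zero.
  have hunit : IsUnit (1 - (-(w - z)) • B) := by
    refine isUnit_one_sub_of_norm_lt_one ?_
    rw [norm_smul, norm_neg]
    nlinarith [norm_nonneg B, norm_nonneg (w - z)]
  let π := Ideal.Quotient.mk zeroSeq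
  have h1' : π B * π (algebraMap ℂ _ z - A) = 1 := by
    rw [← Ideal.Quotient.eq_zero_iff_mem, map_sub, map_one, map_mul, sub_eq_zero] at h1
    exact h1.symm
  have h2' : π (algebraMap ℂ _ z - A) * π B = 1 := by
    rw [← Ideal.Quotient.eq_zero_iff_mem, map_sub, map_one, map_mul, sub_eq_zero] at h2
    exact h2.symm
  have hz' : IsUnit (π (algebraMap ℂ _ z - A)) := ⟨⟨_, _, h2', h1'⟩, rfl⟩
  refine spectrum.notMem_iff.2 ?_
  have h3 : algebraMap ℂ (seqAlg ⧸ zeroSeq) w - π A =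
      π (algebraMap ℂ _ z - A) * π (1 - (-(w - z)) • B) := by
    have h4 : (1 : seqAlg) - (-(w - z)) • B = 1 + algebraMap ℂ _ (w - z) * B := by
      rw [neg_smul, sub_neg_eq_add, Algebra.smul_def]
    rw [h4, map_add, map_one, map_mul, mul_add, mul_one, ← mul_assoc, ← map_mul,
      ← Algebra.commutes (w - z) (algebraMap ℂ _ z - A), map_mul, mul_assoc, h2', mul_one,
      ← map_add]
    change π (algebraMap ℂ _ w) - π A = _
    rw [← map_sub]
    congr 1
    rw [map_sub]
    abel
  rw [h3]
  exact hz'.mul (hunit.map π)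

theorem norm_le_of_mem_eigs {A : seqAlg} {n : ℕ} {z : ℂ} (hz : z ∈ eigs ((A : BddSeq) n)) :
    ‖z‖ ≤ ‖A‖ :=
  (spectrum.norm_le_norm_of_mem ((mem_eigs _ z).1 hz)).trans ((A : BddSeq).norm_apply_le n)

/-- Eigenvalues of the sections stay away from each point outside the stability spectrum. -/
theorem eventually_eigs_notMem_ball {A : seqAlg} {w : ℂ} (hw : w ∉ stabilitySpectrum A) :
    ∃ ε > 0, ∀ᶠ n in atTop, ∀ z ∈ eigs ((A : BddSeq) n), z ∉ Metric.ball w ε := by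
  obtain ⟨B, hB, -⟩ := exists_inverse_mod_zeroSeq hw
  refine ⟨1 / 2 / (‖B‖ + 1), by positivity, ?_⟩
  filter_upwards [(tendsto_order.1 (mem_zeroSeq.1 hB)).2 (1 / 2) (by positivity)] with n hn z hz hzw
  rw [eigs, Polynomial.mem_roots (LinearMap.charpoly_monic _).ne_zero,
    ← Module.End.hasEigenvalue_iff_isRoot_charpoly] at hz
  obtain ⟨v, hv⟩ := hz.exists_hasEigenvector
  have hAv : (A : BddSeq) n v = z • v := hv.apply_eq_smul
  have h1 : ((1 - B * (algebraMap ℂ _ w - A) : seqAlg) : BddSeq) n v =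
      v - (w - z) • (B : BddSeq) n v := by
    have h2 : ((algebraMap ℂ seqAlg w : seqAlg) : BddSeq) n = w • 1 := by
      rw [Algebra.algebraMap_eq_smul_one]
      rfl
    change v - (B : BddSeq) n (((algebraMap ℂ seqAlg w : seqAlg) : BddSeq) n v -
      (A : BddSeq) n v) = _
    rw [h2, hAv, ← map_smul, sub_smul]
    rfl
  have h3 := (((1 - B * (algebraMap ℂ _ w - A) : seqAlg) : BddSeq) n).le_opNorm v
  rw [h1] at h3
  have h4 : ‖(w - z) • (B : BddSeq) n v‖ ≤ ‖w - z‖ * (‖B‖ * ‖v‖) := by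
    rw [norm_smul]
    gcongr
    exact ((B : BddSeq) n).le_of_opNorm_le ((B : BddSeq).norm_apply_le n) v
  have h5 : 0 < ‖v‖ := norm_pos_iff.2 hv.2
  rw [Metric.mem_ball, dist_eq_norm, norm_sub_rev, lt_div_iff₀ (by positivity)] at hzw
  have h6 := norm_sub_norm_le v ((w - z) • (B : BddSeq) n v)
  have h7 : ‖w - z‖ * (‖B‖ * ‖v‖) ≤ 1 / 2 * ‖v‖ := by
    rw [← mul_assoc]
    gcongr
    nlinarith [norm_nonneg (w - z)]
  have h8 := mul_lt_mul_of_pos_right hn h5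
  linarith

theorem eventually_eigs_notMem {A : seqAlg} {C : Set ℂ} (hC : IsClosed C)
    (hd : Disjoint C (stabilitySpectrum A)) :
    ∀ᶠ n in atTop, ∀ z ∈ eigs ((A : BddSeq) n), z ∉ C := by
  have hK : IsCompact (Metric.closedBall (0 : ℂ) ‖A‖ ∩ C) :=
    (isCompact_closedBall _ _).inter_right hC
  have h : ∀ w ∈ Metric.closedBall (0 : ℂ) ‖A‖ ∩ C, ∃ N ∈ 𝓝 w,
      ∀ᶠ n in atTop, ∀ z ∈ eigs ((A : BddSeq) n), z ∉ N := fun w hw => by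
    obtain ⟨ε, hε, h⟩ := eventually_eigs_notMem_ball (Set.disjoint_left.1 hd hw.2)
    exact ⟨_, Metric.ball_mem_nhds w hε, h⟩
  choose! N hN hev using h
  obtain ⟨t, ht, hcov⟩ := hK.elim_nhds_subcover N hN
  filter_upwards [(Filter.eventually_all_finset t).2 fun w hw => hev w (ht w hw)] with n hn z hz hzC
  obtain ⟨w, hw, hzw⟩ := Set.mem_iUnion₂.1
    (hcov ⟨mem_closedBall_zero_iff.2 (norm_le_of_mem_eigs hz), hzC⟩)
  exact hn w hw z hz hzw

/-- There is a compact subset of `U` which contains the stability spectrum and almost all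
eigenvalues of the sections. -/
theorem exists_compact_subset {A : seqAlg} {U : Set ℂ} (hσ : stabilitySpectrum A ⊆ U)
    (hU : IsOpen U ∨ (∃ V : Set ℝ, IsOpen V ∧ U = Complex.ofReal '' V) ∧
      ∀ᶠ n in atTop, ∀ z ∈ eigs ((A : BddSeq) n), z.im = 0) :
    ∃ K ⊆ U, IsCompact K ∧ stabilitySpectrum A ⊆ K ∧
      ∀ᶠ n in atTop, ∀ z ∈ eigs ((A : BddSeq) n), z ∈ K := by
  have hc := isCompact_stabilitySpectrum A
  rcases hU with hU | ⟨⟨V, hV, rfl⟩, hreal⟩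
  · obtain ⟨K, hK, hσK, hKU⟩ := exists_compact_between hc hU hσ
    refine ⟨K, hKU, hK, hσK.trans interior_subset, ?_⟩
    filter_upwards [eventually_eigs_notMem isOpen_interior.isClosed_compl
      (Set.disjoint_left.2 fun z hz hz' => hz (hσK hz'))] with n hn z hz
    exact interior_subset (not_not.1 (hn z hz))
  · have hemb : IsClosedEmbedding Complex.ofReal := Complex.isometry_ofReal.isClosedEmbedding
    have hcr : Complex.ofReal ⁻¹' stabilitySpectrum A ⊆ V := fun x hx => by
      obtain ⟨y, hy, hyx⟩ := hσ hx
      rwa [← Complex.ofReal_injective hyx]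
    obtain ⟨L, hL, hσL, hLV⟩ := exists_compact_between (hemb.isCompact_preimage hc) hV hcr
    refine ⟨Complex.ofReal '' L, Set.image_mono hLV, hL.image Complex.continuous_ofReal, ?_, ?_⟩
    · intro z hz
      obtain ⟨x, -, rfl⟩ := hσ hz
      exact ⟨x, interior_subset (hσL hz), rfl⟩
    · have hd : Disjoint (Complex.ofReal '' (interior L)ᶜ) (stabilitySpectrum A) := by
        rw [Set.disjoint_left]
        rintro _ ⟨x, hx, rfl⟩ hx'
        exact hx (hσL hx')
      filter_upwards [hreal, eventually_eigs_notMem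
        (hemb.isClosedMap _ isOpen_interior.isClosed_compl) hd] with n hn hn' z hz
      have hzr : (z.re : ℂ) = z := Complex.ext rfl (hn z hz).symm
      refine ⟨z.re, interior_subset (not_not.1 fun h => hn' z hz ⟨z.re, h, hzr⟩), hzr⟩

end Szego

end

theorem theorem5p1 (A : Szego.seqAlg) (hA : A ∈ Szego.secAlg Set.univ Szego.AP)
    (hN : IsStarNormal A) (U : Set ℂ) (g : ℂ → ℂ)
    (hσ : Szego.stabilitySpectrum A ⊆ U)
    (hU : IsOpen U ∨
      (∃ V : Set ℝ, IsOpen V ∧ U = Complex.ofReal '' V) ∧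
        ∀ᶠ n in atTop, ∀ z ∈ Szego.eigs ((A : Szego.BddSeq) n), z.im = 0)
    (hg : ContinuousOn g U) :
    (∀ᶠ n in atTop, ∀ z ∈ Szego.eigs ((A : Szego.BddSeq) n), z ∈ U) ∧
    IsStarNormal (Szego.W A) ∧ spectrum ℂ (Szego.W A) ⊆ U ∧
    cfc g (Szego.W A) ∈ Szego.opAlg Set.univ Szego.AP ∧
    Szego.IsDap (cfc g (Szego.W A)) (Szego.Dap (cfc g (Szego.W A))) ∧
    Szego.HasMean (Szego.Dap (cfc g (Szego.W A))) (Szego.mean (Szego.Dap (cfc g (Szego.W A)))) ∧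
    Tendsto (fun n : ℕ =>
        ((Szego.eigs ((A : Szego.BddSeq) n)).map g).sum / ((n + 1 : ℕ) : ℂ)) atTop
      (𝓝 (Szego.mean (Szego.Dap (cfc g (Szego.W A))))) := by
  obtain ⟨K, hKU, hK, hσK, hev⟩ := Szego.exists_compact_subset hσ hU
  have hcfc := Szego.cfc_mem_opAlg (Szego.secAlg_structure hA).1 g
  have hdap := Szego.isDap_Dap hcfc
  refine ⟨hev.mono fun n hn z hz => hKU (hn z hz), IsStarNormal.map Szego.strongLimHom A,
    (Szego.spectrum_W_subset A).trans hσ, hcfc, hdap, Szego.hasMean_mean hdap.1, ?_⟩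
  -- Near the stability spectrum, `g` may be replaced by a function which is continuous on `ℂ`.
  obtain ⟨G, hG⟩ := ContinuousMap.exists_restrict_eq hK.isClosed
    (⟨K.domRestrict g, (hg.mono hKU).domRestrict⟩ : C(K, ℂ))
  have hGg : ∀ z ∈ K, G z = g z := fun z hz => DFunLike.congr_fun hG ⟨z, hz⟩
  have hW : cfc g (Szego.W A) = Szego.W (cfc G A) := by
    rw [Szego.W_cfc A G.continuous]
    exact cfc_congr fun z hz => (hGg z (hσK (Szego.spectrum_W_subset A hz))).symm
  rw [hW]
  refine (Szego.tendsto_trace (Szego.cfc_mem_secAlg hA G)).congr' ?_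
  filter_upwards [hev] with n hn
  have hNn : IsStarNormal ((A : Szego.BddSeq) n) := IsStarNormal.map (Szego.entryHom n) A
  rw [Szego.entry_cfc A G.continuous, Szego.trace_cfc_eq_sum_eigs]
  exact congrArg (fun s : Multiset ℂ => s.sum / ((n + 1 : ℕ) : ℂ))
    (Multiset.map_congr rfl fun z hz => hGg z (hn z hz))
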